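/- Let $\mathcal M$ be a $d$-dimensional smooth, Hausdorff, paracompact manifold (without boundary), $X\subseteq\mathcal M$ a closed subset, $g$ any smooth Riemannian metric on $\mathcal M$, and let $d(A,B)\in[0,\infty]$ denote the infimum of the lengths of paths from $A$ to $B$ ($\infty$ if there are none). For an open set $\Omega\subseteq\mathcal M$, let $\mathscr D(\Omega)$ be the space of smooth functions $\varphi:\Omega\to\mathbb C$ with compact support (extended by zero to $\mathcal M$), and for $K\subseteq\Omega$ compact let $\mathscr D_K$ be the subspace of those with support in $K$, with the topology of uniform convergence of all derivatives on the compact subsets of all charts. A distribution on $\Omega$, i.e. an element of $\mathscr D(\Omega)'$, is a linear form on $\mathscr D(\Omega)$ whose restriction to each $\mathscr D_K$, $K\subseteq\Omega$ compact, is continuous. Fix a family of charts $(V_\alpha,\psi_\alpha)$ of $\mathcal M$ whose domains form a locally finite open covering of $\mathcal M$, and for each $\alpha$ a sequence of compact sets $K_{1,\alpha},K_{2,\alpha},\dots$ with union $\psi_\alpha(V_\alpha)$, each contained in the interior of the next. Put $$p_{k,l,\alpha}(\varphi)=\sup_{x\in K_{l,\alpha},\ j\le k}\bigl\|D^j(\varphi\circ\psi_\alpha^{-1})(x)\bigr\|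 .$$ A distribution $t\in\mathscr D(\mathcal M\setminus X)'$ has moderate growth along $X$ if for every compact $K\subseteq\mathcal M$ there are integers $k,l$, finitely many indices $\alpha_1,\dots,\alpha_q$ and constants $C,s\ge 0$ such that $$|\langle t,\varphi\rangle|\le C\bigl[1+d(\operatorname{Supp}\varphi,X)^{-s}\bigr]\sup_{1\le h\le q}p_{k,l,\alpha_h}(\varphi)$$ for every $\varphi\in\mathscr D(\mathcal M\setminus X)$ with $\operatorname{Supp}\varphi\subseteq K$. Theorem. For every distribution $t\in\mathscr D(\mathcal M\setminus X)'$ the following are equivalent: (i) $t$ has moderate growth along $X$. (ii) $t$ is extendible to $\mathcal M$: there is $u\in\mathscr D(\mathcal M)'$ with $\langle u,\varphi\rangle=\langle t,\varphi\rangle$ for all $\varphi\in\mathscr D(\mathcal M\setminus X)$. (iii) There are a family $(\beta_\lambda)_{\lambda\in(0,1]}$ of smooth functions $\mathcal M\to\mathbb C$ such that each $\beta_\lambda$ is $0$ in a neighbourhood of $X$ and $\lim_{\lambda\to0}\beta_\lambda(x)=1$ for every $x\in\mathcal M\setminus X$, and a family $(c_\lambda)_{\lambda\in(0,1]}$ of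 distributions on $\mathcal M$ supported on $X$, such that $t\beta_\lambda-c_\lambda$ converges as $\lambda\to0$ to a distribution on $\mathcal M$ that extends $t$. Here $\langle t\beta_\lambda,\varphi\rangle=\langle t,\beta_\lambda\varphi\rangle$ for $\varphi\in\mathscr D(\mathcal M)$ (well defined because $\beta_\lambda\varphi\in\mathscr D(\mathcal M\setminus X)$), and convergence means that $\langle t,\beta_\lambda\varphi\rangle-\langle c_\lambda,\varphi\rangle$ converges for every $\varphi\in\mathscr D(\mathcal M)$. -/

import Mathlib

open Set Filter Topology Manifold Bundle TopologicalSpace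
open scoped ContDiff ENNReal NNReal

noncomputable section

namespace DistExt

/-- The algebra of smooth complex valued functions on `M`, as a subalgebra of all functions. -/
def smoothSubalgebra (d : ℕ) (M : Type*) [TopologicalSpace M]
    [ChartedSpace (EuclideanSpace ℝ (Fin d)) M] : Subalgebra ℂ (M → ℂ) where
  carrier := {f | ContMDiff (𝓡 d) 𝓘(ℝ, ℂ) ∞ f}
  mul_mem' hf hg := (contDiff_mul (𝕜 := ℝ) (𝔸 := ℂ)).contMDiff.comp (ContMDiff.prodMk_space hf hg)
  add_mem' hf hg := ContMDiff.add hf hg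
  algebraMap_mem' _ := contMDiff_const

/-- The space `𝓔(M)` of smooth functions `M → ℂ`. It is a type of its own, so that it carries its
`C^∞` topology, defined below, and not the topology of pointwise convergence. -/
def SmoothFunction (d : ℕ) (M : Type*) [TopologicalSpace M]
    [ChartedSpace (EuclideanSpace ℝ (Fin d)) M] : Type _ :=
  smoothSubalgebra d M

section

variable {d : ℕ} {M : Type*} [TopologicalSpace M] [ChartedSpace (EuclideanSpace ℝ (Fin d)) M]

instance : CommRing (SmoothFunction d M) := inferInstanceAs (CommRing (smoothSubalgebra d M))

instance : Algebra ℂ (SmoothFunction d M) := inferInstanceAs (Algebra ℂ (smoothSubalgebra d M))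

instance : CoeFun (SmoothFunction d M) (fun _ => M → ℂ) := ⟨fun f => f.1⟩

theorem SmoothFunction.contMDiff (f : SmoothFunction d M) : ContMDiff (𝓡 d) 𝓘(ℝ, ℂ) ∞ f := f.2

/-- A chart of `M` (a member of the maximal smooth atlas) together with a compact subset of its
range. -/
structure ChartCompact (d : ℕ) (M : Type*) [TopologicalSpace M]
    [ChartedSpace (EuclideanSpace ℝ (Fin d)) M] where
  chart : OpenPartialHomeomorph M (EuclideanSpace ℝ (Fin d))
  mem_maximalAtlas : chart ∈ IsManifold.maximalAtlas (𝓡 d) ∞ M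
  carrier : Set (EuclideanSpace ℝ (Fin d))
  isCompact : IsCompact carrier
  subset_target : carrier ⊆ chart.target

/-- A smooth function read in a chart is smooth on the range of the chart. -/
theorem ChartCompact.contDiffOn [IsManifold (𝓡 d) ∞ M] (L : ChartCompact d M)
    (f : SmoothFunction d M) : ContDiffOn ℝ ∞ (f ∘ L.chart.symm) L.chart.target := by
  rw [← contMDiffOn_iff_contDiffOn]
  exact f.contMDiff.comp_contMDiffOn (contMDiffOn_symm_of_mem_maximalAtlas L.mem_maximalAtlas)

theorem ChartCompact.contDiffAt [IsManifold (𝓡 d) ∞ M] (L : ChartCompact d M)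
    (f : SmoothFunction d M) (j : ℕ) {x : EuclideanSpace ℝ (Fin d)} (hx : x ∈ L.carrier) :
    ContDiffAt ℝ j (f ∘ L.chart.symm) x :=
  ((L.contDiffOn f).contDiffAt (L.chart.open_target.mem_nhds (L.subset_target hx))).of_le
    (by exact_mod_cast le_top)

theorem ChartCompact.bddAbove [IsManifold (𝓡 d) ∞ M] (L : ChartCompact d M)
    (f : SmoothFunction d M) (j : ℕ) :
    BddAbove (range fun x : L.carrier => ‖iteratedFDeriv ℝ j (f ∘ L.chart.symm) x‖) := by
  have h : ContinuousOn (iteratedFDeriv ℝ j (f ∘ L.chart.symm)) L.carrier :=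
    (((L.contDiffOn f).continuousOn_iteratedFDerivWithin (m := j) (by exact_mod_cast le_top)
      L.chart.open_target.uniqueDiffOn).congr
      (fun x hx => (iteratedFDerivWithin_of_isOpen j L.chart.open_target hx).symm)).mono
      L.subset_target
  simpa only [image_eq_range] using L.isCompact.bddAbove_image h.norm

/-- The seminorm `f ↦ sup_{x ∈ L} ‖D^j (f ∘ ψ⁻¹)(x)‖`, for a chart `ψ` and a compact subset `L` of
its range. -/
def derivSeminorm [IsManifold (𝓡 d) ∞ M] (L : ChartCompact d M) (j : ℕ) :
    Seminorm ℂ (SmoothFunction d M) :=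
  Seminorm.of (fun f => ⨆ x : L.carrier, ‖iteratedFDeriv ℝ j (f ∘ L.chart.symm) x‖)
    (fun f g => by
      refine Real.iSup_le (fun x => ?_) (add_nonneg (Real.iSup_nonneg fun _ => norm_nonneg _)
        (Real.iSup_nonneg fun _ => norm_nonneg _))
      have h : iteratedFDeriv ℝ j ((f + g : SmoothFunction d M) ∘ L.chart.symm) x =
          iteratedFDeriv ℝ j (f ∘ L.chart.symm) x + iteratedFDeriv ℝ j (g ∘ L.chart.symm) x :=
        iteratedFDeriv_add_apply (L.contDiffAt f j x.2) (L.contDiffAt g j x.2)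
      rw [h]
      exact (norm_add_le _ _).trans
        (add_le_add (le_ciSup (L.bddAbove f j) x) (le_ciSup (L.bddAbove g j) x)))
    (fun a f => by
      rw [Real.mul_iSup_of_nonneg (norm_nonneg a)]
      congr 1
      ext x
      have h : iteratedFDeriv ℝ j ((a • f : SmoothFunction d M) ∘ L.chart.symm) x =
          a • iteratedFDeriv ℝ j (f ∘ L.chart.symm) x :=
        iteratedFDeriv_const_smul_apply (L.contDiffAt f j x.2)
      rw [h, norm_smul])

/-- The seminorm `f ↦ sup_{x ∈ L, j ≤ k} ‖D^j (f ∘ ψ⁻¹)(x)‖`, for a chart `ψ` and a compact subset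
`L` of its range. -/
def chartSeminorm [IsManifold (𝓡 d) ∞ M] (L : ChartCompact d M) (k : ℕ) :
    Seminorm ℂ (SmoothFunction d M) :=
  (Finset.range (k + 1)).sup (derivSeminorm L)

/-- The `C^∞` topology of `𝓔(M)`: uniform convergence of all derivatives on the compact subsets of
all charts. It is the topology generated by all the seminorms `chartSeminorm L k`. -/
instance [IsManifold (𝓡 d) ∞ M] : TopologicalSpace (SmoothFunction d M) :=
  ⨅ i : ChartCompact d M × ℕ,
    (chartSeminorm i.1 i.2).toSeminormedAddCommGroup.toUniformSpace.toTopologicalSpace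

/-- The space `𝓓_K` of smooth functions with support in `K`. As a subspace of `𝓔(M)` it carries the
induced topology. -/
def supportedIn (d : ℕ) {M : Type*} [TopologicalSpace M]
    [ChartedSpace (EuclideanSpace ℝ (Fin d)) M] (K : Set M) :
    Submodule ℂ (SmoothFunction d M) where
  carrier := {φ | tsupport φ ⊆ K}
  add_mem' {φ ψ} hφ hψ :=
    (tsupport_add (φ : M → ℂ) (ψ : M → ℂ)).trans (union_subset hφ hψ)
  zero_mem' := by
    have h0 : ((0 : SmoothFunction d M) : M → ℂ) = 0 := rfl
    simp [h0, tsupport]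
  smul_mem' a φ hφ :=
    (closure_mono (Function.support_const_smul_subset a (φ : M → ℂ))).trans hφ

/-- The space `𝓓(Ω)` of test functions on the open set `Ω`: smooth functions on `M` whose support
is compact and contained in `Ω` (a test function on `Ω` is extended by zero). -/
def testFunctions (d : ℕ) {M : Type*} [TopologicalSpace M]
    [ChartedSpace (EuclideanSpace ℝ (Fin d)) M] (Ω : Opens M) :
    Submodule ℂ (SmoothFunction d M) where
  carrier := {φ | HasCompactSupport φ ∧ tsupport φ ⊆ Ω}
  add_mem' {φ ψ} hφ hψ :=
    ⟨hφ.1.add hψ.1, (tsupport_add (φ : M → ℂ) (ψ : M → ℂ)).trans (union_subset hφ.2 hψ.2)⟩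
  zero_mem' := by
    have h0 : ((0 : SmoothFunction d M) : M → ℂ) = 0 := rfl
    simp [h0, tsupport, HasCompactSupport]
  smul_mem' a φ hφ := by
    have h : tsupport (a • φ : SmoothFunction d M) ⊆ tsupport φ :=
      closure_mono (Function.support_const_smul_subset a (φ : M → ℂ))
    exact ⟨hφ.1.mono' ((subset_tsupport _).trans h), h.trans hφ.2⟩

theorem supportedIn_le_testFunctions {Ω : Opens M} {K : Set M} (hK : IsCompact K)
    (hKΩ : K ⊆ Ω) : supportedIn d K ≤ testFunctions d Ω := fun _ hφ =>
  ⟨hK.of_isClosed_subset (isClosed_tsupport _) hφ, hφ.trans hKΩ⟩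

theorem testFunctions_mono {Ω Ω' : Opens M} (h : Ω ≤ Ω') :
    testFunctions d Ω ≤ testFunctions d Ω' := fun _ hφ => ⟨hφ.1, hφ.2.trans h⟩

/-- A distribution on the open set `Ω`: a linear form on `𝓓(Ω)` whose restriction to `𝓓_K` is
continuous, for every compact `K ⊆ Ω`. -/
structure MDistribution (d : ℕ) {M : Type*} [TopologicalSpace M]
    [ChartedSpace (EuclideanSpace ℝ (Fin d)) M] [IsManifold (𝓡 d) ∞ M] (Ω : Opens M) where
  toLinearMap : testFunctions d Ω →ₗ[ℂ] ℂ
  continuous_restrict : ∀ (K : Set M) (hK : IsCompact K) (hKΩ : K ⊆ Ω),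
    Continuous fun φ : supportedIn d K =>
      toLinearMap (Submodule.inclusion (supportedIn_le_testFunctions hK hKΩ) φ)

variable [IsManifold (𝓡 d) ∞ M]

instance {Ω : Opens M} : CoeFun (MDistribution d Ω) (fun _ => testFunctions d Ω → ℂ) :=
  ⟨fun t => t.toLinearMap⟩

/-- The support of a distribution `t` on `Ω`: a point `x` of `Ω` is outside the support if it has
an open neighbourhood `V` such that `t` is zero on all test functions supported in `V`. -/
def MDistribution.support {Ω : Opens M} (t : MDistribution d Ω) : Set M :=
  {x | x ∈ Ω ∧ ¬ ∃ V : Opens M, x ∈ V ∧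
    ∀ φ : testFunctions d Ω, tsupport (φ : SmoothFunction d M) ⊆ V → t φ = 0}

/-- The distribution `u` on `M` extends the distribution `t` on `Ω`. -/
def MDistribution.Extends {Ω : Opens M} (u : MDistribution d (⊤ : Opens M))
    (t : MDistribution d Ω) : Prop :=
  ∀ φ : testFunctions d Ω, u (Submodule.inclusion (testFunctions_mono le_top) φ) = t φ

/-- `β = 0` in a neighbourhood of `X`. -/
def VanishesNear (β : SmoothFunction d M) (X : Closeds M) : Prop :=
  ∀ᶠ x in 𝓝ˢ (X : Set M), β x = 0

/-- If `β` vanishes near `X` and `φ` is a test function on `M`, then `β φ` is a test function on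
`M ∖ X`. The action of `t β` on `φ` is then `t (mulTest β hβ φ)`. -/
def mulTest {X : Closeds M} (β : SmoothFunction d M) (hβ : VanishesNear β X)
    (φ : testFunctions d (⊤ : Opens M)) : testFunctions d X.compl :=
  ⟨β * (φ : SmoothFunction d M), HasCompactSupport.mul_left φ.2.1, fun x hx hxX => by
    have h : ∀ᶠ y in 𝓝 x, β y = 0 := hβ.filter_mono (nhds_le_nhdsSet hxX)
    refine notMem_tsupport_iff_eventuallyEq.mpr ?_ hx
    filter_upwards [h] with y hy
    change β y * (φ : SmoothFunction d M) y = 0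
    rw [hy, zero_mul]⟩

/-- A locally finite covering of `M` by domains of charts, and for each of these charts an
exhaustion of its range by compact sets, each contained in the interior of the next one. -/
structure ChartFamily (d : ℕ) (M : Type*) [TopologicalSpace M]
    [ChartedSpace (EuclideanSpace ℝ (Fin d)) M] (ι : Type*) where
  cell : ι → ℕ → ChartCompact d M
  chart : ι → OpenPartialHomeomorph M (EuclideanSpace ℝ (Fin d))
  chart_cell : ∀ α l, (cell α l).chart = chart α
  locallyFinite : LocallyFinite fun α => (chart α).source
  iUnion_source : ⋃ α, (chart α).source = univ
  subset_interior : ∀ α l, (cell α l).carrier ⊆ interior (cell α (l + 1)).carrier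
  iUnion_cell : ∀ α, ⋃ l, (cell α l).carrier = (chart α).target

/-- The distance `inf {d(x, y) | x ∈ A, y ∈ B}` of two sets, for the Riemannian distance (the
infimum of the lengths of paths, which is `∞` for points in different components, as is the
distance to the empty set). -/
def riemannianSetEDist (d : ℕ) {M : Type*} [TopologicalSpace M]
    [ChartedSpace (EuclideanSpace ℝ (Fin d)) M] [IsManifold (𝓡 d) ∞ M]
    [RiemannianBundle (fun x : M => TangentSpace (𝓡 d) x)] (A B : Set M) : ℝ≥0∞ :=
  ⨅ x ∈ A, ⨅ y ∈ B, riemannianEDist (𝓡 d) x y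

/-- The distribution `t` on `M ∖ X` has moderate growth along `X`: for each compact `K ⊆ M`
there are finitely many seminorms `p_{k,l,α}`, `α ∈ S`, and constants `C, s ≥ 0` with
`|t φ| ≤ C (1 + d(supp φ, X)^(-s)) sup_{α ∈ S} p_{k,l,α}(φ)` for all test functions `φ` on
`M ∖ X` with support in `K`. -/
def HasModerateGrowth [RiemannianBundle (fun x : M => TangentSpace (𝓡 d) x)] {ι : Type*}
    (𝒜 : ChartFamily d M ι) {X : Closeds M} (t : MDistribution d X.compl) : Prop :=
  ∀ K : Set M, IsCompact K → ∃ (k l : ℕ) (S : Finset ι) (C s : ℝ≥0),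
    ∀ φ : testFunctions d X.compl, tsupport (φ : SmoothFunction d M) ⊆ K →
      ENNReal.ofReal ‖t φ‖ ≤
        C * (1 + riemannianSetEDist d (tsupport (φ : SmoothFunction d M)) X ^ (-(s : ℝ))) *
          ENNReal.ofReal
            ((S.sup fun α => chartSeminorm (𝒜.cell α l) k) (φ : SmoothFunction d M))

/-- There are smooth `β_λ`, `0 < λ ≤ 1`, that vanish near `X` and tend to `1` pointwise on `M ∖ X`
as `λ → 0`, and distributions `c_λ` on `M` supported on `X`, such that `t β_λ - c_λ` converges, in
the sense of distributions, to a distribution on `M` that extends `t`. -/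
def HasSubtractedLimit {X : Closeds M} (t : MDistribution d X.compl) : Prop :=
  ∃ (β : Ioc (0 : ℝ) 1 → SmoothFunction d M) (hβ : ∀ r, VanishesNear (β r) X)
    (c : Ioc (0 : ℝ) 1 → MDistribution d (⊤ : Opens M)) (u : MDistribution d (⊤ : Opens M)),
    (∀ x ∉ X, Tendsto (fun r => β r x) (comap Subtype.val (𝓝[>] (0 : ℝ))) (𝓝 1)) ∧
    (∀ r, (c r).support ⊆ X) ∧
    (∀ φ : testFunctions d (⊤ : Opens M),
      Tendsto (fun r => t (mulTest (β r) (hβ r) φ) - c r φ)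
        (comap Subtype.val (𝓝[>] (0 : ℝ))) (𝓝 (u φ))) ∧
    u.Extends t

end

end DistExt

end

/-!
A distribution `t` on `M ∖ X` is extended, and its extensions are approximated, with the help of
one estimate. In a chart, let `η` be supported at distance at most `δ` from `X`, with derivatives
of order `i` bounded by `δ⁻ⁱ`. If `f` vanishes near `X`, Taylor's inequality bounds its derivatives
of order `i` at distance at most `δ` from `X` by `δ ^ (m - i)` times a seminorm of order `m`, so that
`η f` has a seminorm of order `k` that is `O(δ ^ (m - k))`
(`ChartCutoff.exists_chartSeminorm_mulComp_le`). A partition of unity `χᵢ` by functions with compact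
support in charts (`exists_chartCutoff_partition`) makes everything local, since a locally finite
sum of linear forms bounded by seminorms of charts is a distribution (`exists_locallyFinite_sum`).

* *Moderate growth implies extendibility.* Cut `χ f`, for `f` that vanishes near `X`, into pieces
  supported at distance about `δₙ = 2⁻ⁿ δ₀` from `X`. The Riemannian distance is bounded below by
  the distance in the chart (`ChartCutoff.exists_le_riemannianSetEDist`), so that `t` grows at most
  like `δₙ⁻ˢ` on the `n`-th piece, and for `m = k + s + 1` the estimate leaves a factor `δₙ`, which
  is summable. So `f ↦ t (χ f)` is bounded by a seminorm on the functions that vanish near `X`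
  (`HasModerateGrowth.exists_norm_mulVanishing_le`). The theorem of Hahn and Banach extends it to all
  smooth functions, and the sum over the partition of unity is an extension of `t`.

* *Extendibility implies moderate growth*, because a distribution on `M` is bounded by finitely many
  seminorms on the functions supported in a compact set, whatever charts are used to express them
  (`MDistribution.exists_norm_le`, `exists_chartSeminorm_le_sup`).

* *Extendibility implies the subtracted limit.* Let `u` extend `t` and let `b` be a cutoff that is `0`
  near `X` and `1` at distance more than `λ` in the chart. By the estimate with `m = k + 1`, the form
  `v f = u (χ (1 - b) f)` is `O(λ)` on the functions that vanish near `X`. By the theorem of Hahn and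
  Banach there is a form `w` that is `O(λ)` on all smooth functions and agrees with `v` on these.
  Then `w - v` is supported on `X` (`MDistribution.exists_local_subtraction`). With `β_λ = ∑ χᵢ bᵢ`
  and `c_λ = ∑ (wᵢ - vᵢ)`, the difference `t β_λ - c_λ - u = - ∑ wᵢ` tends to `0`. No extension
  theorem of Whitney type is needed.
-/

noncomputable section

namespace DistExt

/-! ### Euclidean cutoff functions -/

section Euclidean

open MeasureTheory Metric
open scoped Convolution Pointwise

/-- All derivatives of a convolution `f ⋆ g` with `‖g‖ ≤ 1` are bounded independently of `g`,
since they all fall on `f`. -/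
theorem norm_iteratedFDeriv_convolution_le {E : Type} [NormedAddCommGroup E] [NormedSpace ℝ E]
    [FiniteDimensional ℝ E] [MeasurableSpace E] [BorelSpace E] (μ : Measure E) [μ.IsAddHaarMeasure]
    {B : Type} [NormedAddCommGroup B] [NormedSpace ℝ B] {g : E → B}
    (hg : LocallyIntegrable g μ) (hg1 : ∀ x, ‖g x‖ ≤ 1) (n : ℕ) :
    ∀ {A F : Type} [NormedAddCommGroup A] [NormedSpace ℝ A] [NormedAddCommGroup F]
      [NormedSpace ℝ F] [CompleteSpace F] (L : A →L[ℝ] B →L[ℝ] F) {f : E → A},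
      HasCompactSupport f → ContDiff ℝ ∞ f → ∀ x,
      ‖iteratedFDeriv ℝ n (f ⋆[L, μ] g) x‖ ≤ ‖L‖ * ∫ t, ‖iteratedFDeriv ℝ n f t‖ ∂μ := by
  induction n with
  | zero =>
    intro A F _ _ _ _ _ L f hf hfs x
    simp only [norm_iteratedFDeriv_zero]
    rw [convolution, ← integral_const_mul]
    refine norm_integral_le_of_norm_le
      (((hfs.continuous.integrable_of_hasCompactSupport hf).norm).const_mul _)
      (Eventually.of_forall fun t => ?_)
    calc ‖L (f t) (g (x - t))‖ ≤ ‖L‖ * ‖f t‖ * ‖g (x - t)‖ := L.le_opNorm₂ _ _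
      _ ≤ ‖L‖ * ‖f t‖ * 1 := by gcongr; exact hg1 _
      _ = ‖L‖ * ‖f t‖ := mul_one _
  | succ n ih =>
    intro A F _ _ _ _ _ L f hf hfs x
    have hd : fderiv ℝ (f ⋆[L, μ] g) = (fderiv ℝ f ⋆[L.precompL E, μ] g) := by
      ext1 y
      exact (hf.hasFDerivAt_convolution_left L (hfs.of_le (by exact_mod_cast le_top)) hg y).fderiv
    rw [← norm_iteratedFDeriv_fderiv, hd]
    simp_rw [← norm_iteratedFDeriv_fderiv (f := f)]
    refine (ih (L.precompL E) (hf.fderiv (𝕜 := ℝ)) (hfs.fderiv_right (by simp)) x).trans ?_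
    gcongr
    exact ContinuousLinearMap.norm_precompL_le E L

/-- The unit scale case of `exists_cutoff`. -/
theorem exists_unit_cutoff (d : ℕ) : ∃ C : ℕ → ℝ, ∀ G : Set (EuclideanSpace ℝ (Fin d)),
    ∃ b : EuclideanSpace ℝ (Fin d) → ℂ, ContDiff ℝ ∞ b ∧
      (∀ y ∈ cthickening (1 / 4) G, b y = 0) ∧ (∀ y ∉ cthickening 1 G, b y = 1) ∧
      ∀ i y, ‖iteratedFDeriv ℝ i b y‖ ≤ C i := by
  let E := EuclideanSpace ℝ (Fin d)
  let ρ : ContDiffBump (0 : E) := ⟨1 / 8, 1 / 4, by norm_num, by norm_num⟩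
  refine ⟨fun i => ‖(ContinuousLinearMap.lsmul ℝ ℝ : ℝ →L[ℝ] ℂ →L[ℝ] ℂ)‖ *
    ∫ t, ‖iteratedFDeriv ℝ i (ρ.normed volume) t‖, fun G => ?_⟩
  let g : E → ℂ := (cthickening (1 / 2) G)ᶜ.indicator fun _ => 1
  have hm : MeasurableSet (cthickening (1 / 2) G)ᶜ := isClosed_cthickening.measurableSet.compl
  have hg : LocallyIntegrable g volume :=
    (locallyIntegrable_const (1 : ℂ)).indicator hm
  have hg1 : ∀ x, ‖g x‖ ≤ 1 := fun x => by
    exact (norm_indicator_le_norm_self _ _).trans (by simp)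
  -- `g` is constant on balls of radius `1/4` centered off the shell between `1/4` and `1`.
  have key : ∀ {x y : E} {r : ℝ}, y ∈ ball x (1 / 4) → 0 ≤ r → x ∈ cthickening r G →
      y ∈ cthickening (r + 1 / 4) G := fun {x y r} hy hr hx => by
    refine cthickening_cthickening_subset (by norm_num : (0 : ℝ) ≤ 1 / 4) hr G |>.trans
      (by rw [add_comm]) ?_
    exact thickening_subset_cthickening _ _ (mem_thickening_iff.2 ⟨x, hx, hy⟩)
  refine ⟨(ρ.normed volume ⋆[ContinuousLinearMap.lsmul ℝ ℝ, volume] g),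
    ρ.hasCompactSupport_normed.contDiff_convolution_left _ ρ.contDiff_normed hg,
    fun x hx => ?_, fun x hx => ?_, fun i y =>
      norm_iteratedFDeriv_convolution_le volume hg hg1 i _ ρ.hasCompactSupport_normed
        ρ.contDiff_normed y⟩
  · have h0 : ∀ y ∈ ball x (1 / 4), g y = 0 := fun y hy => by
      have := key hy (by norm_num) hx
      exact indicator_of_notMem (by norm_num at this ⊢; exact this) _
    rw [ρ.normed_convolution_eq_right fun y hy => (h0 y hy).trans
      (h0 x (mem_ball_self (by norm_num))).symm]
    exact h0 x (mem_ball_self (by norm_num))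
  · have h0 : ∀ y ∈ ball x (1 / 4), g y = 1 := fun y hy => by
      have : y ∉ cthickening (1 / 2) G := fun h => hx <| by
        have h2 := key (mem_ball_comm.1 hy) (by norm_num) h
        exact cthickening_mono (by norm_num) G h2
      exact indicator_of_mem (mem_compl this) _
    rw [ρ.normed_convolution_eq_right fun y hy => (h0 y hy).trans
      (h0 x (mem_ball_self (by norm_num))).symm]
    exact h0 x (mem_ball_self (by norm_num))

/-- Cutoff functions that vanish near `F` and are `1` at distance more than `δ` from it, with
derivatives of order `i` bounded by `δ⁻ⁱ` up to a constant that depends on neither `δ` nor `F`. -/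
theorem exists_cutoff (d : ℕ) : ∃ C : ℕ → ℝ, ∀ (F : Set (EuclideanSpace ℝ (Fin d))) (δ : ℝ), 0 < δ →
    ∃ b : EuclideanSpace ℝ (Fin d) → ℂ, ContDiff ℝ ∞ b ∧
      (∀ y ∈ cthickening (δ / 4) F, b y = 0) ∧ (∀ y ∉ cthickening δ F, b y = 1) ∧
      ∀ i y, ‖iteratedFDeriv ℝ i b y‖ ≤ C i * δ⁻¹ ^ i := by
  obtain ⟨C, hC⟩ := exists_unit_cutoff d
  refine ⟨C, fun F δ hδ => ?_⟩
  obtain ⟨b, hb, h0, h1, hbC⟩ := hC (δ⁻¹ • F)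
  have hth : ∀ (r : ℝ) y, 0 ≤ r →
      (δ⁻¹ • y ∈ cthickening r (δ⁻¹ • F) ↔ y ∈ cthickening (δ * r) F) := fun r y hr => by
    rw [mem_cthickening_iff, mem_cthickening_iff, infEDist_smul₀ (inv_ne_zero hδ.ne'),
      ENNReal.ofReal_mul hδ.le, ENNReal.smul_def, smul_eq_mul]
    have : ((‖δ⁻¹‖₊ : ℝ≥0) : ℝ≥0∞) = (ENNReal.ofReal δ)⁻¹ := by
      rw [← ENNReal.ofReal_inv_of_pos hδ, ← enorm_eq_nnnorm, Real.enorm_of_nonneg (by positivity)]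
    rw [this, ← ENNReal.div_eq_inv_mul, mul_comm (ENNReal.ofReal δ)]
    exact ENNReal.div_le_iff (by simpa using hδ) ENNReal.ofReal_ne_top
  let A : EuclideanSpace ℝ (Fin d) →L[ℝ] EuclideanSpace ℝ (Fin d) :=
    δ⁻¹ • ContinuousLinearMap.id ℝ _
  have hA : ‖A‖ ≤ δ⁻¹ := by
    refine (norm_smul_le (δ⁻¹) (ContinuousLinearMap.id ℝ (EuclideanSpace ℝ (Fin d)))).trans ?_
    rw [Real.norm_of_nonneg (by positivity)]
    exact mul_le_of_le_one_right (by positivity) ContinuousLinearMap.norm_id_le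
  refine ⟨b ∘ A, hb.comp A.contDiff, fun y hy => h0 _ ?_, fun y hy => h1 _ ?_, fun i y => ?_⟩
  · exact (hth (1 / 4) y (by norm_num)).2 (by rwa [mul_one_div])
  · exact fun h => hy (by simpa using (hth _ _ (by norm_num)).1 h)
  · rw [A.iteratedFDeriv_comp_right hb y (by exact_mod_cast le_top)]
    refine (ContinuousMultilinearMap.norm_compContinuousLinearMap_le _ _).trans ?_
    simp only [Finset.prod_const, Finset.card_univ, Fintype.card_fin]
    gcongr
    · exact (norm_nonneg _).trans (hbC i 0)
    · exact hbC i _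

/-! ### Functions that vanish near a closed set -/

variable {E : Type*} [NormedAddCommGroup E] [NormedSpace ℝ E] {F : Type*} [NormedAddCommGroup F]
  [NormedSpace ℝ F]

/-- A form of Taylor's inequality: if `g` vanishes near the center of a ball of radius `δ` and its
derivatives up to order `m` are bounded by `P` there, then the derivatives of order `j` are bounded
by `P δ ^ (m - j)`. -/
theorem norm_iteratedFDeriv_le_of_eventuallyEq_zero {g : E → F} {m : ℕ} {z : E} {δ P : ℝ}
    (hδ : 0 ≤ δ) (hg : ∀ w ∈ closedBall z δ, ContDiffAt ℝ m g w) (hz : g =ᶠ[𝓝 z] 0)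
    (hP : ∀ i ≤ m, ∀ w ∈ closedBall z δ, ‖iteratedFDeriv ℝ i g w‖ ≤ P) {j : ℕ} (hj : j ≤ m) :
    ∀ w ∈ closedBall z δ, ‖iteratedFDeriv ℝ j g w‖ ≤ P * δ ^ (m - j) := by
  induction hj using Nat.decreasingInduction with
  | self => intro w hw; simpa using hP m le_rfl w hw
  | of_succ k hk ih =>
    intro w hw
    have hz0 : iteratedFDeriv ℝ k g z = 0 := by
      rw [(hz.iteratedFDeriv ℝ k).eq_of_nhds]
      simp
    have hzb : z ∈ closedBall z δ := mem_closedBall_self hδ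
    have := (convex_closedBall z δ).norm_image_sub_le_of_norm_fderiv_le (𝕜 := ℝ)
      (f := iteratedFDeriv ℝ k g) (C := P * δ ^ (m - (k + 1))) (fun x hx =>
        (hg x hx).differentiableAt_iteratedFDeriv (by exact_mod_cast hk))
      (fun x hx => by rw [norm_fderiv_iteratedFDeriv]; exact ih x hx) hzb hw
    rw [hz0, sub_zero] at this
    refine this.trans ?_
    have hP0 : 0 ≤ P := (norm_nonneg _).trans (hP 0 (Nat.zero_le _) z hzb)
    have e : m - k = m - (k + 1) + 1 := by omega
    rw [e, pow_succ, ← mul_assoc]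
    gcongr
    simpa [dist_eq_norm] using hw

/-- The Leibniz rule for the norms of the iterated derivatives at a point. -/
theorem norm_iteratedFDeriv_mul_le_of_contDiffAt {f g : E → ℂ} {n : ℕ} {x : E}
    (hf : ContDiffAt ℝ n f x) (hg : ContDiffAt ℝ n g x) :
    ‖iteratedFDeriv ℝ n (fun y => f y * g y) x‖ ≤ ∑ i ∈ Finset.range (n + 1),
      (n.choose i : ℝ) * ‖iteratedFDeriv ℝ i f x‖ * ‖iteratedFDeriv ℝ (n - i) g x‖ := by
  obtain ⟨u, hu, hfu⟩ := hf.contDiffOn le_rfl (by simp)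
  obtain ⟨v, hv, hgv⟩ := hg.contDiffOn le_rfl (by simp)
  obtain ⟨s, hs, hso, hxs⟩ := _root_.mem_nhds_iff.1 (inter_mem hu hv)
  have h := norm_iteratedFDerivWithin_mul_le (hfu.mono (hs.trans inter_subset_left))
    (hgv.mono (hs.trans inter_subset_right)) hso.uniqueDiffOn hxs le_rfl
  simpa only [iteratedFDerivWithin_of_isOpen _ hso hxs] using h

/-- If `‖Dⁱ f‖ ≤ A δ⁻ⁱ` and `‖Dⁱ g‖ ≤ B δ ^ (m - i)` at a point for `i ≤ n`, then
`‖Dⁿ (f g)‖ ≤ 2ⁿ A B δ ^ (m - n)`: the powers of `δ` compensate in each term of the Leibniz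
rule. -/
theorem norm_iteratedFDeriv_mul_le_of_scale {f g : E → ℂ} {n m : ℕ} {x : E} {δ A B : ℝ}
    (hδ : 0 < δ) (hnm : n ≤ m) (hf : ContDiffAt ℝ n f x) (hg : ContDiffAt ℝ n g x)
    (hfA : ∀ i ≤ n, ‖iteratedFDeriv ℝ i f x‖ ≤ A * δ⁻¹ ^ i)
    (hgB : ∀ i ≤ n, ‖iteratedFDeriv ℝ i g x‖ ≤ B * δ ^ (m - i)) :
    ‖iteratedFDeriv ℝ n (fun y => f y * g y) x‖ ≤ 2 ^ n * A * B * δ ^ (m - n) := by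
  refine (norm_iteratedFDeriv_mul_le_of_contDiffAt hf hg).trans ?_
  have h2 : (2 : ℝ) ^ n = ∑ i ∈ Finset.range (n + 1), (n.choose i : ℝ) := by
    exact_mod_cast (Nat.sum_range_choose n).symm
  rw [h2, Finset.sum_mul, Finset.sum_mul, Finset.sum_mul]
  refine Finset.sum_le_sum fun i hi => ?_
  have hi : i ≤ n := Finset.mem_range_succ_iff.1 hi
  have hA : 0 ≤ A * δ⁻¹ ^ i := (norm_nonneg _).trans (hfA i hi)
  calc (n.choose i : ℝ) * ‖iteratedFDeriv ℝ i f x‖ * ‖iteratedFDeriv ℝ (n - i) g x‖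
      ≤ n.choose i * (A * δ⁻¹ ^ i) * (B * δ ^ (m - (n - i))) := by
        gcongr
        · exact hfA i hi
        · exact hgB _ (Nat.sub_le _ _)
    _ = n.choose i * A * B * δ ^ (m - n) := by
        have : m - (n - i) = (m - n) + i := by omega
        rw [this, pow_add, inv_pow]
        field_simp

end Euclidean

/-! ### Seminorms in charts -/

section Seminorms

variable {d : ℕ} {M : Type*} [TopologicalSpace M] [ChartedSpace (EuclideanSpace ℝ (Fin d)) M]

/-- The compact subset of `M` that corresponds to the compact subset of the range of the chart. -/
def ChartCompact.points (L : ChartCompact d M) : Set M := L.chart.symm '' L.carrier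

theorem ChartCompact.isCompact_points (L : ChartCompact d M) : IsCompact L.points :=
  L.isCompact.image_of_continuousOn (L.chart.continuousOn_symm.mono L.subset_target)

theorem ChartCompact.mem_points {L : ChartCompact d M} {x : M} :
    x ∈ L.points ↔ x ∈ L.chart.source ∧ L.chart x ∈ L.carrier := by
  constructor
  · rintro ⟨y, hy, rfl⟩
    have := L.subset_target hy
    exact ⟨L.chart.map_target this, by rwa [L.chart.right_inv this]⟩
  · rintro ⟨h, h'⟩
    exact ⟨_, h', L.chart.left_inv h⟩

theorem ChartCompact.symm_mem_points {L : ChartCompact d M} {y : EuclideanSpace ℝ (Fin d)}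
    (hy : y ∈ L.carrier) : L.chart.symm y ∈ L.points := mem_image_of_mem _ hy

theorem ChartCompact.comp_symm_eventuallyEq_zero {L : ChartCompact d M} {f : M → ℂ}
    {y : EuclideanSpace ℝ (Fin d)} (hy : y ∈ L.carrier) (h : f =ᶠ[𝓝 (L.chart.symm y)] 0) :
    f ∘ L.chart.symm =ᶠ[𝓝 y] 0 :=
  (L.chart.continuousAt_symm (L.subset_target hy)).eventually h

variable [IsManifold (𝓡 d) ∞ M]

theorem norm_le_derivSeminorm (L : ChartCompact d M) (j : ℕ) (f : SmoothFunction d M)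
    {y : EuclideanSpace ℝ (Fin d)} (hy : y ∈ L.carrier) :
    ‖iteratedFDeriv ℝ j (f ∘ L.chart.symm) y‖ ≤ derivSeminorm L j f :=
  le_ciSup (L.bddAbove f j) (⟨y, hy⟩ : L.carrier)

theorem norm_le_chartSeminorm (L : ChartCompact d M) {j k : ℕ} (hj : j ≤ k)
    (f : SmoothFunction d M) {y : EuclideanSpace ℝ (Fin d)} (hy : y ∈ L.carrier) :
    ‖iteratedFDeriv ℝ j (f ∘ L.chart.symm) y‖ ≤ chartSeminorm L k f :=
  (norm_le_derivSeminorm L j f hy).trans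
    (Seminorm.le_finset_sup_apply (Finset.mem_range_succ_iff.2 hj))

theorem chartSeminorm_le {L : ChartCompact d M} {k : ℕ} {f : SmoothFunction d M} {C : ℝ}
    (hC : 0 ≤ C) (h : ∀ j ≤ k, ∀ y ∈ L.carrier,
      ‖iteratedFDeriv ℝ j (f ∘ L.chart.symm) y‖ ≤ C) : chartSeminorm L k f ≤ C :=
  Seminorm.finset_sup_apply_le hC fun j hj =>
    Real.iSup_le (fun y => h j (Finset.mem_range_succ_iff.1 hj) y y.2) hC

theorem chartSeminorm_mono (L : ChartCompact d M) {k m : ℕ} (h : k ≤ m) (f : SmoothFunction d M) :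
    chartSeminorm L k f ≤ chartSeminorm L m f :=
  chartSeminorm_le (apply_nonneg _ _) fun _ hj _ hy => norm_le_chartSeminorm L (hj.trans h) f hy

theorem chartSeminorm_eq_zero_of_disjoint {L : ChartCompact d M} {f : SmoothFunction d M}
    (h : Disjoint L.points (tsupport f)) (k : ℕ) : chartSeminorm L k f = 0 := by
  refine le_antisymm (chartSeminorm_le le_rfl fun j _ y hy => ?_) (apply_nonneg _ _)
  have h0 := L.comp_symm_eventuallyEq_zero hy (notMem_tsupport_iff_eventuallyEq.1
    (h.notMem_of_mem_left (L.symm_mem_points hy)))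
  rw [(h0.iteratedFDeriv ℝ j).eq_of_nhds]
  simp

/-- On the part of `M` covered by `L'`, the derivatives in the chart of `L` are bounded by those in
the chart of `L'`, by the chain rule for the transition map. -/
theorem exists_norm_le_chartSeminorm [T2Space M] (L L' : ChartCompact d M) (k : ℕ) :
    ∃ C : ℝ, 0 ≤ C ∧ ∀ f : SmoothFunction d M, ∀ y ∈ L.carrier, L.chart.symm y ∈ L'.points →
      ∀ j ≤ k, ‖iteratedFDeriv ℝ j (f ∘ L.chart.symm) y‖ ≤ C * chartSeminorm L' k f := by
  let O := L.chart.target ∩ L.chart.symm ⁻¹' L'.chart.source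
  have hO : IsOpen O := L.chart.symm.isOpen_inter_preimage L'.chart.open_source
  let τ := L'.chart ∘ L.chart.symm
  have hτ : ContDiffOn ℝ ∞ τ O := by
    rw [← contMDiffOn_iff_contDiffOn]
    exact (contMDiffOn_of_mem_maximalAtlas L'.mem_maximalAtlas).comp
      ((contMDiffOn_symm_of_mem_maximalAtlas L.mem_maximalAtlas).mono inter_subset_left)
      inter_subset_right
  let Z := L.carrier ∩ L.chart.symm ⁻¹' L'.points
  have hZO : Z ⊆ O := fun y hy => ⟨L.subset_target hy.1, (L'.mem_points.1 hy.2).1⟩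
  have hZ : IsCompact Z :=
    L.isCompact.of_isClosed_subset ((L.chart.continuousOn_symm.mono
      L.subset_target).preimage_isClosed_of_isClosed L.isCompact.isClosed
        L'.isCompact_points.isClosed) inter_subset_left
  have hb : ∀ i : ℕ, ∃ D : ℝ, 0 ≤ D ∧ ∀ y ∈ Z, ‖iteratedFDerivWithin ℝ i τ O y‖ ≤ D := fun i => by
    obtain ⟨D, hD⟩ := hZ.exists_bound_of_continuousOn
      ((hτ.continuousOn_iteratedFDerivWithin (m := i) (by exact_mod_cast le_top)
        hO.uniqueDiffOn).mono hZO)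
    exact ⟨max D 0, le_max_right _ _, fun y hy => (hD y hy).trans (le_max_left _ _)⟩
  choose D hD0 hD using hb
  let B := 1 + ∑ i ∈ Finset.range (k + 1), D i
  have hB : 1 ≤ B := le_add_of_nonneg_right (Finset.sum_nonneg fun i _ => hD0 i)
  refine ⟨k.factorial * B ^ k, by positivity, fun f y hy hyL j hj => ?_⟩
  have hyZ : y ∈ Z := ⟨hy, hyL⟩
  have hcomp := norm_iteratedFDerivWithin_comp_le (n := j) (N := ∞) (L'.contDiffOn f) hτ
    (by exact_mod_cast le_top) L'.chart.open_target.uniqueDiffOn hO.uniqueDiffOn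
    (fun x hx => L'.chart.map_source hx.2) (hZO hyZ) (C := chartSeminorm L' k f) (D := B)
    (fun i hi => by
      have : τ y ∈ L'.carrier := (L'.mem_points.1 hyL).2
      rw [iteratedFDerivWithin_of_isOpen _ L'.chart.open_target (L'.subset_target this)]
      exact norm_le_chartSeminorm L' (hi.trans hj) f this)
    (fun i hi1 hi => by
      refine (hD i y hyZ).trans (le_trans ?_ (le_self_pow₀ hB (by omega)))
      have := Finset.single_le_sum (f := D) (fun i _ => hD0 i)
        (Finset.mem_range_succ_iff.2 (hi.trans hj))
      linarith)
  have heq : EqOn (f ∘ L.chart.symm) ((f ∘ L'.chart.symm) ∘ τ) O := fun x hx => by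
    simp only [Function.comp_apply, τ, L'.chart.left_inv hx.2]
  rw [← iteratedFDerivWithin_of_isOpen _ hO (hZO hyZ), iteratedFDerivWithin_congr heq (hZO hyZ)]
  refine hcomp.trans ?_
  rw [mul_right_comm]
  gcongr

/-- On functions supported in a compact set that is covered by finitely many of the compact sets
of a family, every seminorm `chartSeminorm L k` is bounded by those of the family. -/
theorem exists_chartSeminorm_le_sup [T2Space M] {κ : Type*} (L' : κ → ChartCompact d M)
    (S : Finset κ) {K : Set M} (hK : K ⊆ ⋃ i ∈ S, (L' i).points) (L : ChartCompact d M) (k : ℕ) :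
    ∃ C : ℝ, 0 ≤ C ∧ ∀ f : SmoothFunction d M, tsupport f ⊆ K →
      chartSeminorm L k f ≤ C * (S.sup fun i => chartSeminorm (L' i) k) f := by
  choose C hC0 hC using fun i => exists_norm_le_chartSeminorm L (L' i) k
  have hsum : 0 ≤ ∑ i ∈ S, C i := Finset.sum_nonneg fun i _ => hC0 i
  refine ⟨∑ i ∈ S, C i, hsum, fun f hf =>
    chartSeminorm_le (mul_nonneg hsum (apply_nonneg _ _)) fun j hj y hy => ?_⟩
  by_cases hyf : L.chart.symm y ∈ tsupport f
  · obtain ⟨i, hi, hyi⟩ := mem_iUnion₂.1 (hK (hf hyf))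
    refine (hC i f y hy hyi j hj).trans ?_
    gcongr
    · exact Finset.single_le_sum (fun i _ => hC0 i) hi
    · exact Seminorm.le_finset_sup_apply (p := fun i => chartSeminorm (L' i) k) hi
  · have h0 := L.comp_symm_eventuallyEq_zero hy (notMem_tsupport_iff_eventuallyEq.1 hyf)
    rw [(h0.iteratedFDeriv ℝ j).eq_of_nhds]
    simpa using mul_nonneg hsum (apply_nonneg _ _)

/-- On functions supported in the compact set of `L`, every seminorm of order `k` is bounded by
`chartSeminorm L k`. -/
theorem exists_chartSeminorm_le [T2Space M] (L₀ L : ChartCompact d M) (k : ℕ) :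
    ∃ C : ℝ, 0 ≤ C ∧ ∀ f : SmoothFunction d M, tsupport f ⊆ L.points →
      chartSeminorm L₀ k f ≤ C * chartSeminorm L k f := by
  simpa using exists_chartSeminorm_le_sup (fun _ : Unit => L) {()} (K := L.points)
    (fun x hx => mem_iUnion₂.2 ⟨(), Finset.mem_singleton_self _, hx⟩) L₀ k

/-- Multiplication by a smooth function is bounded for each of the seminorms. -/
theorem exists_chartSeminorm_mul_le (L : ChartCompact d M) (χ : SmoothFunction d M) (k : ℕ) :
    ∃ C : ℝ, 0 ≤ C ∧ ∀ f : SmoothFunction d M,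
      chartSeminorm L k (χ * f) ≤ C * chartSeminorm L k f := by
  refine ⟨2 ^ k * chartSeminorm L k χ, by positivity, fun f =>
    chartSeminorm_le (by positivity) fun j hj y hy => ?_⟩
  have h := norm_iteratedFDeriv_mul_le_of_scale (f := χ ∘ L.chart.symm) (g := f ∘ L.chart.symm)
    (x := y) (δ := 1) one_pos (le_refl j) (L.contDiffAt χ j hy) (L.contDiffAt f j hy)
    (A := chartSeminorm L k χ) (B := chartSeminorm L k f)
    (fun i hi => by simpa using norm_le_chartSeminorm L (hi.trans hj) χ hy)
    (fun i hi => by simpa using norm_le_chartSeminorm L (hi.trans hj) f hy)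
  rw [one_pow, mul_one] at h
  refine h.trans ?_
  gcongr
  norm_num

end Seminorms

/-! ### Cutoff functions in charts -/

section Pieces

variable {d : ℕ} {M : Type*} [TopologicalSpace M] [ChartedSpace (EuclideanSpace ℝ (Fin d)) M]

/-- The smooth functions that vanish in a neighbourhood of `X`. -/
def vanishingNear (d : ℕ) {M : Type*} [TopologicalSpace M]
    [ChartedSpace (EuclideanSpace ℝ (Fin d)) M] (X : Closeds M) :
    Submodule ℂ (SmoothFunction d M) where
  carrier := {f | VanishesNear f X}
  add_mem' {f g} hf hg := by
    have hf : VanishesNear f X := hf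
    have hg : VanishesNear g X := hg
    change ∀ᶠ x in 𝓝ˢ (X : Set M), (f + g : SmoothFunction d M) x = 0
    filter_upwards [hf, hg] with x hfx hgx
    change f x + g x = 0
    rw [hfx, hgx, add_zero]
  zero_mem' := (Eventually.of_forall fun _ => rfl :
    ∀ᶠ x in 𝓝ˢ (X : Set M), (0 : SmoothFunction d M) x = 0)
  smul_mem' a f hf := by
    have hf : VanishesNear f X := hf
    change ∀ᶠ x in 𝓝ˢ (X : Set M), (a • f : SmoothFunction d M) x = 0
    filter_upwards [hf] with x hfx
    change a • f x = 0
    rw [hfx, smul_zero]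

theorem VanishesNear.mul_right {f : SmoothFunction d M} {X : Closeds M} (hf : VanishesNear f X)
    (g : SmoothFunction d M) : VanishesNear (g * f) X := by
  filter_upwards [hf] with x hx
  change g x * f x = 0
  rw [hx, mul_zero]

theorem VanishesNear.tsupport_subset {f : SmoothFunction d M} {X : Closeds M}
    (hf : VanishesNear f X) : tsupport f ⊆ X.compl := fun _ hx hxX =>
  notMem_tsupport_iff_eventuallyEq.2 (hf.filter_mono (nhds_le_nhdsSet hxX)) hx

theorem vanishesNear_of_tsupport_subset {f : SmoothFunction d M} {X : Closeds M}
    (hf : tsupport f ⊆ X.compl) : VanishesNear f X := by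
  rw [VanishesNear, eventually_nhdsSet_iff_forall]
  exact fun x hx => notMem_tsupport_iff_eventuallyEq.1 fun h => hf h hx

/-- A smooth function whose support is contained in a compact part of the range of a chart, with a
margin of width `radius` in the chart. -/
structure ChartCutoff (d : ℕ) (M : Type*) [TopologicalSpace M]
    [ChartedSpace (EuclideanSpace ℝ (Fin d)) M] extends ChartCompact d M where
  cutoff : SmoothFunction d M
  tsupport_subset : tsupport cutoff ⊆ toChartCompact.points
  radius : ℝ
  radius_pos : 0 < radius
  radius_le_one : radius ≤ 1
  cthickening_subset : Metric.cthickening radius (chart '' tsupport cutoff) ⊆ carrier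

namespace ChartCutoff

variable (Q : ChartCutoff d M)

theorem isCompact_tsupport : IsCompact (tsupport Q.cutoff) :=
  Q.isCompact_points.of_isClosed_subset (isClosed_tsupport _) Q.tsupport_subset

theorem tsupport_subset_source : tsupport Q.cutoff ⊆ Q.chart.source := fun _ hx =>
  (ChartCompact.mem_points.1 (Q.tsupport_subset hx)).1

/-- The part of `X` in the compact set of `Q`, read in the chart. -/
def trace (X : Closeds M) : Set (EuclideanSpace ℝ (Fin d)) :=
  Q.chart '' (X ∩ Q.points)

theorem isCompact_trace (X : Closeds M) : IsCompact (Q.trace X) :=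
  (Q.isCompact_points.inter_left X.isClosed).image_of_continuousOn
    (Q.chart.continuousOn.mono fun _ hx => (ChartCompact.mem_points.1 hx.2).1)

theorem trace_subset (X : Closeds M) : Q.trace X ⊆ Q.carrier := by
  rintro _ ⟨x, hx, rfl⟩
  exact (ChartCompact.mem_points.1 hx.2).2

theorem symm_mem_of_mem_trace {X : Closeds M} {z : EuclideanSpace ℝ (Fin d)}
    (hz : z ∈ Q.trace X) : Q.chart.symm z ∈ X := by
  obtain ⟨x, hx, rfl⟩ := hz
  rw [Q.chart.left_inv (ChartCompact.mem_points.1 hx.2).1]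
  exact hx.1

/-- The product of the cutoff function and of a smooth function `η` in the chart. -/
def mulComp (η : EuclideanSpace ℝ (Fin d) → ℂ) (hη : ContDiff ℝ ∞ η) : SmoothFunction d M :=
  ⟨fun x => Q.cutoff x * η (Q.chart x), contMDiff_of_tsupport fun x hx => by
    have hx : x ∈ tsupport Q.cutoff := closure_mono (Function.support_mul_subset_left _ _) hx
    refine (contDiff_mul (𝕜 := ℝ) (𝔸 := ℂ)).contMDiff.contMDiffAt.comp x
      (ContMDiffAt.prodMk_space Q.cutoff.contMDiff.contMDiffAt
        (hη.contMDiff.contMDiffAt.comp x ?_))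
    exact contMDiffAt_of_mem_maximalAtlas Q.mem_maximalAtlas (Q.tsupport_subset_source hx)⟩

theorem mulComp_apply (η : EuclideanSpace ℝ (Fin d) → ℂ) (hη : ContDiff ℝ ∞ η) (x : M) :
    Q.mulComp η hη x = Q.cutoff x * η (Q.chart x) := rfl

theorem tsupport_mulComp_subset (η : EuclideanSpace ℝ (Fin d) → ℂ) (hη : ContDiff ℝ ∞ η) :
    tsupport (Q.mulComp η hη) ⊆ tsupport Q.cutoff :=
  closure_mono (Function.support_mul_subset_left _ _)

theorem tsupport_mulComp_mul_subset (η : EuclideanSpace ℝ (Fin d) → ℂ) (hη : ContDiff ℝ ∞ η)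
    (f : SmoothFunction d M) :
    tsupport (Q.mulComp η hη * f : SmoothFunction d M) ⊆ tsupport Q.cutoff :=
  (closure_mono (Function.support_mul_subset_left _ _)).trans (Q.tsupport_mulComp_subset η hη)

theorem isCompact_tsupport_mulComp (η : EuclideanSpace ℝ (Fin d) → ℂ) (hη : ContDiff ℝ ∞ η) :
    HasCompactSupport (Q.mulComp η hη) :=
  Q.isCompact_tsupport.of_isClosed_subset (isClosed_tsupport _) (Q.tsupport_mulComp_subset η hη)

/-- If `η` vanishes near the trace of `X`, then the product vanishes near `X`. -/
theorem vanishesNear_mulComp {X : Closeds M} {η : EuclideanSpace ℝ (Fin d) → ℂ}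
    (hη : ContDiff ℝ ∞ η) {δ : ℝ} (hδ : 0 < δ)
    (h0 : ∀ y ∈ Metric.cthickening δ (Q.trace X), η y = 0) : VanishesNear (Q.mulComp η hη) X := by
  rw [VanishesNear, eventually_nhdsSet_iff_forall]
  intro x hx
  by_cases hxs : x ∈ tsupport Q.cutoff
  · have hz : Q.chart x ∈ Q.trace X := ⟨x, ⟨hx, Q.tsupport_subset hxs⟩, rfl⟩
    have hn : Metric.cthickening δ (Q.trace X) ∈ 𝓝 (Q.chart x) :=
      mem_of_superset (Metric.closedBall_mem_nhds _ hδ) (Metric.closedBall_subset_cthickening hz δ)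
    filter_upwards [(Q.chart.continuousAt (Q.tsupport_subset_source hxs)) hn] with y hy
    rw [mulComp_apply, h0 _ hy, mul_zero]
  · filter_upwards [notMem_tsupport_iff_eventuallyEq.1 hxs] with y hy
    rw [mulComp_apply, hy, Pi.zero_apply, zero_mul]

variable [IsManifold (𝓡 d) ∞ M]

/-- **The main estimate.** Let `η` be supported at distance at most `δ` from the trace of `X`, with
derivatives of order `i` bounded by `B δ⁻ⁱ`. For `f` that vanishes near `X`, the derivatives of `f`
of order `i` at distance at most `δ` from `X` are `O(δ ^ (m - i))` by Taylor's inequality, so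
that those of the product of `f` with `η` are, too. -/
theorem exists_chartSeminorm_mulComp_le (X : Closeds M) {k m : ℕ} (hkm : k ≤ m) {B : ℝ}
    (hB : 0 ≤ B) : ∃ A : ℝ, 0 ≤ A ∧ ∀ δ : ℝ, 0 < δ → 2 * δ ≤ Q.radius →
      ∀ (η : EuclideanSpace ℝ (Fin d) → ℂ) (hη : ContDiff ℝ ∞ η),
      (∀ i ≤ k, ∀ y, ‖iteratedFDeriv ℝ i η y‖ ≤ B * δ⁻¹ ^ i) →
      (∀ y ∉ Metric.cthickening δ (Q.trace X), η y = 0) →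
      ∀ f ∈ vanishingNear d X, chartSeminorm Q.toChartCompact k (Q.mulComp η hη * f) ≤
        A * δ ^ (m - k) * chartSeminorm Q.toChartCompact m f := by
  let L := Q.toChartCompact
  let P₀ := chartSeminorm L k Q.cutoff
  have hP₀ : 0 ≤ P₀ := apply_nonneg _ _
  refine ⟨2 ^ k * P₀ * (2 ^ k * B), by positivity, fun δ hδ hδr η hη hηB hη0 f hf =>
    chartSeminorm_le (by positivity) fun j hj y hy => ?_⟩
  have hδ1 : δ ≤ 1 := by linarith [Q.radius_le_one]
  let P := chartSeminorm L m f
  have hP : 0 ≤ P := apply_nonneg _ _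
  have hzero : ∀ {h : EuclideanSpace ℝ (Fin d) → ℂ}, h =ᶠ[𝓝 y] 0 →
      ‖iteratedFDeriv ℝ j h y‖ ≤ 2 ^ k * P₀ * (2 ^ k * B) * δ ^ (m - k) * P := fun h0 => by
    rw [(h0.iteratedFDeriv ℝ j).eq_of_nhds]
    simpa using by positivity
  by_cases hys : L.chart.symm y ∈ tsupport Q.cutoff
  swap
  · exact hzero (L.comp_symm_eventuallyEq_zero hy (notMem_tsupport_iff_eventuallyEq.1
      fun h => hys (Q.tsupport_mulComp_mul_subset η hη f h)))
  have hyt := L.subset_target hy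
  -- In the chart, the product is `cutoff * (η * f)` near `y`.
  have hprod : ((Q.mulComp η hη * f : SmoothFunction d M) : M → ℂ) ∘ L.chart.symm =ᶠ[𝓝 y]
      fun w => (Q.cutoff ∘ L.chart.symm) w * (η w * (f ∘ L.chart.symm) w) := by
    filter_upwards [L.chart.open_target.mem_nhds hyt] with w hw
    change Q.cutoff (L.chart.symm w) * η (L.chart (L.chart.symm w)) * f (L.chart.symm w) = _
    rw [L.chart.right_inv hw, mul_assoc]
    rfl
  by_cases hyF : y ∈ Metric.cthickening δ (Q.trace X)
  swap
  · refine hzero (hprod.trans ?_)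
    filter_upwards [Metric.isClosed_cthickening.isOpen_compl.mem_nhds hyF] with w hw
    rw [hη0 w hw, zero_mul, mul_zero, Pi.zero_apply]
  rw [(Q.isCompact_trace X).cthickening_eq_biUnion_closedBall hδ.le] at hyF
  obtain ⟨z, hz, hyz⟩ := mem_iUnion₂.1 hyF
  have hball : Metric.closedBall z δ ⊆ L.carrier := by
    have hyi : y ∈ L.chart '' tsupport Q.cutoff := ⟨_, hys, L.chart.right_inv hyt⟩
    refine Subset.trans ?_ Q.cthickening_subset
    refine Subset.trans ?_ (Metric.closedBall_subset_cthickening hyi _)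
    refine Metric.closedBall_subset_closedBall' ?_
    rw [Metric.mem_closedBall, dist_comm] at hyz
    linarith
  have hfz : f ∘ L.chart.symm =ᶠ[𝓝 z] 0 :=
    L.comp_symm_eventuallyEq_zero (Q.trace_subset X hz)
      (Eventually.filter_mono (nhds_le_nhdsSet (Q.symm_mem_of_mem_trace hz)) hf)
  have htaylor : ∀ i ≤ k, ‖iteratedFDeriv ℝ i (f ∘ L.chart.symm) y‖ ≤ P * δ ^ (m - i) :=
    fun i hi => norm_iteratedFDeriv_le_of_eventuallyEq_zero hδ.le
      (fun w hw => L.contDiffAt f m (hball hw)) hfz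
      (fun i hi w hw => norm_le_chartSeminorm L hi f (hball hw)) (hi.trans hkm) y hyz
  have hηf : ∀ i ≤ k, ‖iteratedFDeriv ℝ i (fun w => η w * (f ∘ L.chart.symm) w) y‖ ≤
      2 ^ k * B * P * δ ^ (m - k) := fun i hi => by
    refine (norm_iteratedFDeriv_mul_le_of_scale hδ (hi.trans hkm)
      (hη.contDiffAt.of_le (by exact_mod_cast le_top)) (L.contDiffAt f i hy)
      (fun l hl => hηB l (hl.trans hi) y) fun l hl => htaylor l (hl.trans hi)).trans ?_
    gcongr 2 ^ ?_ * B * P * ?_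
    · norm_num
    · exact pow_le_pow_of_le_one hδ.le hδ1 (by omega)
  rw [(hprod.iteratedFDeriv ℝ j).eq_of_nhds]
  refine (norm_iteratedFDeriv_mul_le_of_scale (δ := 1) (m := j) one_pos le_rfl
    (L.contDiffAt Q.cutoff j hy)
    ((hη.contDiffAt.of_le (by exact_mod_cast le_top)).mul (L.contDiffAt f j hy))
    (A := P₀) (B := 2 ^ k * B * P * δ ^ (m - k))
    (fun i hi => by simpa using norm_le_chartSeminorm L (hi.trans hj) Q.cutoff hy)
    (fun i hi => by simpa using hηf i (hi.trans hj))).trans ?_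
  calc 2 ^ j * P₀ * (2 ^ k * B * P * δ ^ (m - k)) * 1 ^ (j - j)
      ≤ 2 ^ k * P₀ * (2 ^ k * B * P * δ ^ (m - k)) * 1 := by
        gcongr
        · norm_num
        · simp
    _ = _ := by ring

end ChartCutoff

end Pieces

/-! ### Distributions and seminorms -/

section Distributions

variable {d : ℕ} {M : Type*} [TopologicalSpace M] [ChartedSpace (EuclideanSpace ℝ (Fin d)) M]

@[ext]
theorem SmoothFunction.ext {f g : SmoothFunction d M} (h : ∀ x, f x = g x) : f = g :=
  Subtype.ext (funext h)

theorem SmoothFunction.mul_apply (f g : SmoothFunction d M) (x : M) : (f * g) x = f x * g x := rfl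

theorem SmoothFunction.sub_apply (f g : SmoothFunction d M) (x : M) : (f - g) x = f x - g x := rfl

theorem SmoothFunction.sum_apply {κ : Type*} (S : Finset κ) (f : κ → SmoothFunction d M) (x : M) :
    (∑ i ∈ S, f i) x = ∑ i ∈ S, f i x :=
  map_sum (⟨⟨fun f => f x, rfl⟩, fun _ _ => rfl⟩ : SmoothFunction d M →+ ℂ) f S

variable [IsManifold (𝓡 d) ∞ M]

instance : IsTopologicalAddGroup (SmoothFunction d M) :=
  topologicalAddGroup_iInf fun i =>
    letI := (chartSeminorm i.1 i.2).toSeminormedAddCommGroup (E := SmoothFunction d M)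
    inferInstance

theorem withSeminorms_chartSeminorm (d : ℕ) (M : Type*) [TopologicalSpace M]
    [ChartedSpace (EuclideanSpace ℝ (Fin d)) M] [IsManifold (𝓡 d) ∞ M] :
    WithSeminorms fun i : ChartCompact d M × ℕ => chartSeminorm i.1 i.2 :=
  (SeminormFamily.withSeminorms_iff_topologicalSpace_eq_iInf _).2 rfl

/-- A distribution is of finite order on the functions supported in a compact set, and it is
enough to use seminorms of a finite family of charts that covers this set. -/
theorem MDistribution.exists_norm_le [T2Space M] {Ω : Opens M} (u : MDistribution d Ω)
    {κ : Type*} (L : κ → ChartCompact d M) (S : Finset κ) {K : Set M} (hK : IsCompact K)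
    (hKΩ : K ⊆ Ω) (hKL : K ⊆ ⋃ i ∈ S, (L i).points) :
    ∃ (k : ℕ) (C : ℝ), 0 ≤ C ∧ ∀ φ : testFunctions d Ω, tsupport (φ : SmoothFunction d M) ⊆ K →
      ‖u φ‖ ≤ C * (S.sup fun i => chartSeminorm (L i) k) (φ : SmoothFunction d M) := by
  let v : supportedIn d K →ₗ[ℂ] ℂ := u.toLinearMap ∘ₗ
    Submodule.inclusion (supportedIn_le_testFunctions hK hKΩ)
  have hv : Continuous v := u.continuous_restrict K hK hKΩ
  obtain ⟨s, D, -, hs⟩ := Seminorm.bound_comp_of_isInducing (p := (normSeminorm ℂ ℂ).comp v)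
    (f := (supportedIn d K).subtype) (continuous_norm.comp hv) (withSeminorms_chartSeminorm d M)
    IsInducing.subtypeVal
  let k := s.sup Prod.snd
  choose C hC0 hC using fun i : ChartCompact d M × ℕ => exists_chartSeminorm_le_sup L S hKL i.1 k
  have hsum : 0 ≤ ∑ i ∈ s, C i := Finset.sum_nonneg fun i _ => hC0 i
  refine ⟨k, D * ∑ i ∈ s, C i, mul_nonneg D.2 hsum, fun φ hφ => ?_⟩
  refine (hs ⟨φ, hφ⟩).trans ?_
  change (D : ℝ) * s.sup (fun i : ChartCompact d M × ℕ => chartSeminorm i.1 i.2)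
    (φ : SmoothFunction d M) ≤ _
  rw [mul_assoc]
  refine mul_le_mul_of_nonneg_left (Seminorm.finset_sup_apply_le
    (mul_nonneg hsum (apply_nonneg _ _)) fun i hi => ?_) D.2
  refine (chartSeminorm_mono i.1 (Finset.le_sup (f := Prod.snd) hi) _).trans
    ((hC i φ hφ).trans ?_)
  gcongr
  exact Finset.single_le_sum (fun i _ => hC0 i) hi

/-- A linear form on `𝓓(Ω)` that is bounded by finitely many seminorms on the functions supported in
a given compact set is a distribution. -/
def MDistribution.ofBound {Ω : Opens M} (u : testFunctions d Ω →ₗ[ℂ] ℂ)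
    (h : ∀ K : Set M, IsCompact K → K ⊆ Ω → ∃ (S : Finset (ChartCompact d M × ℕ))
      (C : ChartCompact d M × ℕ → ℝ), ∀ φ : testFunctions d Ω,
      tsupport (φ : SmoothFunction d M) ⊆ K →
        ‖u φ‖ ≤ ∑ i ∈ S, C i * chartSeminorm i.1 i.2 (φ : SmoothFunction d M)) :
    MDistribution d Ω where
  toLinearMap := u
  continuous_restrict K hK hKΩ := by
    obtain ⟨S, C, hC⟩ := h K hK hKΩ
    refine continuous_of_continuousAt_zero
      (u ∘ₗ Submodule.inclusion (supportedIn_le_testFunctions hK hKΩ)) ?_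
    have hg : Continuous fun φ : supportedIn d K =>
        ∑ i ∈ S, C i * chartSeminorm i.1 i.2 (φ : SmoothFunction d M) :=
      continuous_finsetSum _ fun i _ => continuous_const.mul
        (((withSeminorms_chartSeminorm d M).continuous_seminorm i).comp continuous_subtype_val)
    have h0 := hg.tendsto 0
    simp only [ZeroMemClass.coe_zero, map_zero, mul_zero, Finset.sum_const_zero] at h0
    rw [ContinuousAt, map_zero]
    exact squeeze_zero_norm (fun φ => hC _ φ.2) h0

omit [IsManifold (𝓡 d) ∞ M] in
theorem exists_finset_disjoint {κ : Type*} {L : κ → ChartCompact d M}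
    (hL : LocallyFinite fun i => (L i).points) {K : Set M} (hK : IsCompact K) :
    ∃ S : Finset κ, ∀ i ∉ S, Disjoint (L i).points K := by
  refine ⟨(hL.finite_nonempty_inter_compact hK).toFinset, fun i hi => ?_⟩
  rw [Set.Finite.mem_toFinset, mem_ofPred_eq, not_nonempty_iff_eq_empty] at hi
  exact disjoint_iff_inter_eq_empty.2 hi

/-- The sum of a family of linear forms on `𝓔(M)`, each bounded by a seminorm of a compact set,
is a distribution if the compact sets are locally finite. -/
theorem exists_locallyFinite_sum {κ : Type*} {L : κ → ChartCompact d M}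
    (hL : LocallyFinite fun i => (L i).points) (w : κ → SmoothFunction d M →ₗ[ℂ] ℂ) (m : κ → ℕ)
    (C : κ → ℝ) (hw : ∀ i f, ‖w i f‖ ≤ C i * chartSeminorm (L i) (m i) f) :
    ∃ u : MDistribution d (⊤ : Opens M), ∀ (φ : testFunctions d (⊤ : Opens M)) (S : Finset κ),
      (∀ i ∉ S, Disjoint (L i).points (tsupport (φ : SmoothFunction d M))) →
        u φ = ∑ i ∈ S, w i φ := by
  have hzero : ∀ (f : SmoothFunction d M) i, Disjoint (L i).points (tsupport f) → w i f = 0 :=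
    fun f i hi => norm_le_zero_iff.1 <| by
      simpa [chartSeminorm_eq_zero_of_disjoint hi] using hw i f
  have hsum : ∀ (f : SmoothFunction d M) (S : Finset κ),
      (∀ i ∉ S, Disjoint (L i).points (tsupport f)) → ∑ᶠ i, w i f = ∑ i ∈ S, w i f :=
    fun f S hS => finsum_eq_sum_of_support_subset _ fun i hi => by
      by_contra h
      exact hi (hzero f i (hS i h))
  have hfin : ∀ φ : testFunctions d (⊤ : Opens M),
      (Function.support fun i => w i (φ : SmoothFunction d M)).Finite := fun φ => by
    obtain ⟨S, hS⟩ := exists_finset_disjoint hL φ.2.1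
    refine S.finite_toSet.subset fun i hi => ?_
    by_contra h
    exact hi (hzero _ i (hS i h))
  let u : testFunctions d (⊤ : Opens M) →ₗ[ℂ] ℂ :=
    { toFun := fun φ => ∑ᶠ i, w i (φ : SmoothFunction d M)
      map_add' := fun φ ψ => by
        rw [← finsum_add_distrib (hfin φ) (hfin ψ)]
        simp
      map_smul' := fun a φ => by
        rw [RingHom.id_apply, smul_finsum' a (hfin φ)]
        simp }
  refine ⟨MDistribution.ofBound u fun K hK _ => ?_, fun φ S hS => hsum φ S hS⟩
  classical
  obtain ⟨S, hS⟩ := exists_finset_disjoint hL hK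
  refine ⟨S.image fun i => (L i, m i), fun p => ∑ i ∈ S with (L i, m i) = p, C i, fun φ hφ => ?_⟩
  change ‖∑ᶠ i, w i (φ : SmoothFunction d M)‖ ≤ _
  rw [hsum φ S fun i hi => (hS i hi).mono_right hφ]
  refine (norm_sum_le _ _).trans ((Finset.sum_le_sum fun i _ => hw i φ).trans_eq ?_)
  rw [← Finset.sum_fiberwise_of_maps_to (g := fun i => (L i, m i))
    fun i hi => Finset.mem_image_of_mem _ hi]
  refine Finset.sum_congr rfl fun p _ => ?_
  rw [Finset.sum_mul]
  refine Finset.sum_congr rfl fun i hi => ?_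
  rw [← (Finset.mem_filter.1 hi).2]

end Distributions

/-! ### Partitions of unity -/

section Partition

universe u

variable {d : ℕ} {M : Type*} [TopologicalSpace M] [ChartedSpace (EuclideanSpace ℝ (Fin d)) M]

/-- A smooth function with compact support in the domain of a chart and in an open set `W` is the
cutoff function of some `ChartCutoff` with compact set contained in `W`. -/
theorem exists_chartCutoff {χ : SmoothFunction d M} (hχ : HasCompactSupport χ)
    {e : OpenPartialHomeomorph M (EuclideanSpace ℝ (Fin d))}
    (he : e ∈ IsManifold.maximalAtlas (𝓡 d) ∞ M) (hχe : tsupport χ ⊆ e.source) {W : Set M}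
    (hW : IsOpen W) (hχW : tsupport χ ⊆ W) :
    ∃ Q : ChartCutoff d M, Q.cutoff = χ ∧ Q.points ⊆ W := by
  let D := e '' tsupport χ
  have hD : IsCompact D := hχ.image_of_continuousOn (e.continuousOn.mono hχe)
  have hO : IsOpen (e.target ∩ e.symm ⁻¹' W) := e.symm.isOpen_inter_preimage hW
  have hDO : D ⊆ e.target ∩ e.symm ⁻¹' W := by
    rintro _ ⟨x, hx, rfl⟩
    exact ⟨e.map_source (hχe hx), by simpa [e.left_inv (hχe hx)] using hχW hx⟩
  obtain ⟨r, hr, hrO⟩ := hD.exists_cthickening_subset_open hO hDO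
  have hsub : Metric.cthickening (min r 1) D ⊆ e.target ∩ e.symm ⁻¹' W :=
    (Metric.cthickening_mono (min_le_left _ _) D).trans hrO
  let L : ChartCompact d M := ⟨e, he, Metric.cthickening (min r 1) D, hD.cthickening,
    hsub.trans inter_subset_left⟩
  refine ⟨⟨L, χ, fun x hx => ChartCompact.mem_points.2 ⟨hχe hx,
    Metric.self_subset_cthickening _ (mem_image_of_mem _ hx)⟩, min r 1, by positivity,
    min_le_right _ _, Subset.rfl⟩, rfl, ?_⟩
  rintro _ ⟨y, hy, rfl⟩
  exact (hsub hy).2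

/-- A paracompact manifold has a smooth bump covering by functions with supports in an open covering
such that the corresponding members of the covering are locally finite. In contrast to
`SmoothBumpCovering.exists_isSubordinate`, `M` may have uncountably many components. -/
theorem exists_smoothBumpCovering_locallyFinite (d : ℕ) (M : Type u) [TopologicalSpace M]
    [ChartedSpace (EuclideanSpace ℝ (Fin d)) M] [T2Space M] [ParacompactSpace M]
    [IsManifold (𝓡 d) ∞ M] : ∃ (κ : Type u) (fs : SmoothBumpCovering κ (𝓡 d) M univ)
      (W : κ → Set M), (∀ i, IsOpen (W i)) ∧ LocallyFinite W ∧ ∀ i, tsupport (fs i) ⊆ W i := by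
  have : LocallyCompactSpace M := ChartedSpace.locallyCompactSpace (EuclideanSpace ℝ (Fin d)) M
  choose N hN hxN using fun x : M => exists_compact_mem_nhds x
  obtain ⟨W, hWo, hWu, hWf, hWN⟩ := precise_refinement (fun x => interior (N x))
    (fun x => isOpen_interior)
    (iUnion_eq_univ_iff.2 fun x => ⟨x, mem_interior_iff_mem_nhds.2 (hxN x)⟩)
  obtain ⟨V, hVu, hVc, hVW⟩ := exists_iUnion_eq_closed_subset hWo (fun x => hWf.point_finite x) hWu
  have hVk : ∀ x, IsCompact (V x) := fun x => (hN x).of_isClosed_subset (hVc x)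
    ((hVW x).trans ((hWN x).trans interior_subset))
  have hb : ∀ (x : M) (c : V x), ∃ f : SmoothBumpFunction (𝓡 d) (c : M), tsupport f ⊆ W x :=
    fun x c => by
      obtain ⟨f, -, hf⟩ := (SmoothBumpFunction.nhds_basis_tsupport (I := 𝓡 d)
        (c : M)).mem_iff.1 ((hWo x).mem_nhds (hVW x c.2))
      exact ⟨f, hf⟩
  choose f hf using hb
  have ht : ∀ x, ∃ t : Finset (V x), V x ⊆ ⋃ c ∈ t, {y | f x c =ᶠ[𝓝 y] 1} := fun x =>
    (hVk x).elim_finite_subcover (fun c : V x => {y | f x c =ᶠ[𝓝 y] 1})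
      (fun c => isOpen_setOfPred_eventually_nhds)
      fun c hc => mem_iUnion.2 ⟨⟨c, hc⟩, (f x ⟨c, hc⟩).eventuallyEq_one⟩
  choose t ht using ht
  have hW : LocallyFinite fun i : Σ x, t x => W i.1 := fun y => by
    obtain ⟨U, hU, hUf⟩ := hWf y
    exact ⟨U, hU, hUf.preimage' fun x _ => (Set.finite_range (Sigma.mk x)).subset
      fun i hi => by obtain ⟨x, c⟩ := i; obtain rfl : _ = _ := hi; exact mem_range_self c⟩
  refine ⟨Σ x, t x, ⟨fun i => (i.2 : V i.1), fun i => f i.1 i.2, fun _ => mem_univ _,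
    hW.subset fun i => (subset_tsupport _).trans (hf _ _), fun y _ => ?_⟩,
    fun i => W i.1, fun i => hWo _, hW, fun i => hf _ _⟩
  obtain ⟨x, hx⟩ := mem_iUnion.1 (hVu.symm.subset (mem_univ y))
  obtain ⟨c, hct, hc⟩ := mem_iUnion₂.1 (ht x hx)
  exact ⟨⟨x, c, hct⟩, hc⟩

/-- There is a smooth partition of unity by cutoff functions in charts with locally finite compact
sets. -/
theorem exists_chartCutoff_partition (d : ℕ) (M : Type u) [TopologicalSpace M]
    [ChartedSpace (EuclideanSpace ℝ (Fin d)) M] [T2Space M] [ParacompactSpace M]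
    [IsManifold (𝓡 d) ∞ M] : ∃ (κ : Type u) (Q : κ → ChartCutoff d M),
      (LocallyFinite fun i => (Q i).points) ∧ ∀ x, ∑ᶠ i, (Q i).cutoff x = 1 := by
  obtain ⟨κ, fs, W, hWo, hW, hfW⟩ := exists_smoothBumpCovering_locallyFinite d M
  let ρ := fs.toSmoothPartitionOfUnity
  let χ : κ → SmoothFunction d M := fun i => ⟨fun x => (ρ i x : ℂ),
    Complex.ofRealCLM.contDiff.contMDiff.comp (ρ i).contMDiff⟩
  have hχ : ∀ i, tsupport (χ i) ⊆ tsupport (fs i) := fun i => closure_mono fun x hx =>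
    fs.support_toSmoothPartitionOfUnity_subset i fun h => hx <| by
      change (ρ i x : ℂ) = 0
      exact_mod_cast h
  choose Q hQ hQW using fun i => exists_chartCutoff (χ := χ i)
    ((fs i).hasCompactSupport.of_isClosed_subset (isClosed_tsupport _) (hχ i))
    (IsManifold.chart_mem_maximalAtlas (fs.c i))
    ((hχ i).trans (fs i).tsupport_subset_chartAt_source) (hWo i) ((hχ i).trans (hfW i))
  refine ⟨κ, Q, hW.subset hQW, fun x => ?_⟩
  simp_rw [hQ]
  change ∑ᶠ i, ((ρ i x : ℝ) : ℂ) = 1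
  have h := Complex.ofRealHom.toAddMonoidHom.map_finsum (f := fun i => ρ i x)
    (ρ.locallyFinite.point_finite x)
  rw [ρ.sum_eq_one (mem_univ x)] at h
  simpa using h.symm

/-- A partition of unity reproduces a test function by a finite sum. -/
theorem sum_cutoff_mul_eq {κ : Type*} {Q : κ → ChartCutoff d M}
    (hQ : ∀ x, ∑ᶠ i, (Q i).cutoff x = 1) {φ : SmoothFunction d M} {S : Finset κ}
    (hS : ∀ i ∉ S, Disjoint (Q i).points (tsupport φ)) :
    ∑ i ∈ S, (Q i).cutoff * φ = φ := by
  ext x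
  rw [SmoothFunction.sum_apply]
  simp_rw [SmoothFunction.mul_apply]
  rw [← Finset.sum_mul]
  by_cases hx : x ∈ tsupport φ
  · rw [← finsum_eq_sum_of_support_subset (fun i => (Q i).cutoff x), hQ x, one_mul]
    intro i hi
    by_contra h
    exact (hS i h).le_bot ⟨(Q i).tsupport_subset (subset_tsupport _ hi), hx⟩
  · rw [image_eq_zero_of_notMem_tsupport hx, mul_zero]

end Partition

/-! ### The Riemannian distance in a chart -/

section Riemannian

variable {d : ℕ} {M : Type*} [TopologicalSpace M] [ChartedSpace (EuclideanSpace ℝ (Fin d)) M]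
  [IsManifold (𝓡 d) ∞ M] [RiemannianBundle (fun x : M => TangentSpace (𝓡 d) x)]
  [IsContinuousRiemannianBundle (EuclideanSpace ℝ (Fin d)) (fun x : M => TangentSpace (𝓡 d) x)]

attribute [local instance] normedAddCommGroupTangentSpaceVectorSpace
attribute [local instance] normedSpaceTangentSpaceVectorSpace

open MeasureTheory Metric

/-- Near `z`, points at small Riemannian distance are close in the preferred chart at `z`, with a
linear control: as long as a path stays near `z`, the length of its image in the chart is at most
`C` times its length, so that a short path from a point near `z` has no time to leave. -/
theorem exists_edist_extChartAt_lt [RegularSpace M] (z : M) {s : Set M} (hs : s ∈ 𝓝 z) :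
    ∃ C : ℝ≥0, 0 < C ∧ ∃ r : ℝ≥0, 0 < r ∧ ∀ᶠ x in 𝓝 z, ∀ y, ∀ ρ : ℝ≥0, ρ ≤ r →
      riemannianEDist (𝓡 d) x y < ρ / C →
        y ∈ s ∧ edist (extChartAt (𝓡 d) z x) (extChartAt (𝓡 d) z y) < ρ := by
  obtain ⟨C, C_pos, hC⟩ := eventually_enorm_mfderiv_extChartAt_lt (𝓡 d) z
  obtain ⟨u, u_mem, u_closed, hu'⟩ := exists_mem_nhds_isClosed_subset
    (inter_mem (inter_mem hs hC) (extChartAt_source_mem_nhds (I := 𝓡 d) z))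
  have us : u ⊆ s := fun x hx => (hu' hx).1.1
  have hu := fun x (hx : x ∈ u) => (hu' hx).1.2
  have uc : u ⊆ (extChartAt (𝓡 d) z).source := fun x hx => (hu' hx).2
  have uc' : u ⊆ (chartAt (EuclideanSpace ℝ (Fin d)) z).source := by
    simpa [extChartAt_source] using uc
  obtain ⟨v, ⟨v_mem, v_open⟩, hv⟩ : ∃ v, (v ∈ 𝓝 z ∧ IsOpen v) ∧ v ⊆ u :=
    (nhds_basis_opens' z).mem_iff.1 u_mem
  obtain ⟨r, r_pos, hr⟩ : ∃ r > 0,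
      ball (extChartAt (𝓡 d) z z) r ⊆ (extChartAt (𝓡 d) z).symm ⁻¹' v :=
    Metric.mem_nhds_iff.1 (extChartAt_preimage_mem_nhds v_mem)
  lift r to ℝ≥0 using r_pos.le
  have r_pos : 0 < r := by exact_mod_cast r_pos
  refine ⟨C, C_pos, r / 2, by positivity, ?_⟩
  have hball : ∀ᶠ x in 𝓝 z, extChartAt (𝓡 d) z x ∈ ball (extChartAt (𝓡 d) z z) (r / 2) :=
    (continuousAt_extChartAt z).eventually (ball_mem_nhds _ (by positivity))
  filter_upwards [u_mem, hball] with x hxu hxb y ρ hρ hy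
  obtain ⟨γ, hγx, hγy, γ_smooth, hγ, -⟩ :=
    exists_lt_locally_constant_of_riemannianEDist_lt hy zero_lt_one
  let γ' := extChartAt (𝓡 d) z ∘ γ
  have hρ0 : 0 < ρ := by
    rcases eq_or_lt_of_le (zero_le (a := ρ)) with h | h
    · simp [← h] at hy
    · exact h
  -- As long as the path stays in `u`, its image in the chart has length less than `ρ`.
  have key : ∀ t₁ : ℝ, 0 ≤ t₁ → t₁ ≤ 1 → Icc 0 t₁ ⊆ γ ⁻¹' u → ‖γ' t₁ - γ' 0‖ₑ < ρ := by
    intro t₁ ht₁0 ht₁1 t₁_mem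
    rcases ht₁0.eq_or_lt with rfl | h't'
    · simpa using hρ0
    have hC : ContMDiffOn 𝓘(ℝ, ℝ) 𝓘(ℝ, EuclideanSpace ℝ (Fin d)) 1 γ' (Icc 0 t₁) :=
      contMDiffOn_extChartAt.comp (I' := 𝓡 d)
        (t := (chartAt (EuclideanSpace ℝ (Fin d)) z).source)
        γ_smooth.contMDiffOn (fun t' ht' ↦ uc' <| t₁_mem ht')
    calc
      ‖γ' t₁ - γ' 0‖ₑ
    _ ≤ ∫⁻ t' in Icc 0 t₁, ‖derivWithin γ' (Icc 0 t₁) t'‖ₑ := by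
      apply enorm_sub_le_lintegral_derivWithin_Icc_of_contDiffOn_Icc _ ht₁0
      rwa [← contMDiffOn_iff_contDiffOn]
    _ = ∫⁻ t' in Icc 0 t₁,
        ‖mfderivWithin 𝓘(ℝ, ℝ) 𝓘(ℝ, EuclideanSpace ℝ (Fin d)) γ' (Icc 0 t₁) t' 1‖ₑ := by
      simp_rw [← fderivWithin_derivWithin, mfderivWithin_eq_fderivWithin]
      rfl
    _ ≤ ∫⁻ t' in Icc 0 t₁, C * ‖mfderivWithin 𝓘(ℝ, ℝ) (𝓡 d) γ (Icc 0 t₁) t' 1‖ₑ := by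
      apply setLIntegral_mono' measurableSet_Icc (fun t' ht' ↦ ?_)
      have : mfderivWithin 𝓘(ℝ, ℝ) 𝓘(ℝ, EuclideanSpace ℝ (Fin d)) γ' (Icc 0 t₁) t' =
          (mfderiv (𝓡 d) 𝓘(ℝ, EuclideanSpace ℝ (Fin d)) (extChartAt (𝓡 d) z) (γ t')) ∘L
            (mfderivWithin 𝓘(ℝ, ℝ) (𝓡 d) γ (Icc 0 t₁) t') := by
        apply mfderiv_comp_mfderivWithin
        · exact mdifferentiableAt_extChartAt (uc' (t₁_mem ht'))
        · exact (γ_smooth.mdifferentiable one_ne_zero).mdifferentiableOn _ ht'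
        · rw [uniqueMDiffWithinAt_iff_uniqueDiffWithinAt]
          exact uniqueDiffOn_Icc h't' _ ht'
      have : mfderivWithin 𝓘(ℝ, ℝ) 𝓘(ℝ, EuclideanSpace ℝ (Fin d)) γ' (Icc 0 t₁) t' 1 =
          (mfderiv (𝓡 d) 𝓘(ℝ, EuclideanSpace ℝ (Fin d)) (extChartAt (𝓡 d) z) (γ t'))
            (mfderivWithin 𝓘(ℝ, ℝ) (𝓡 d) γ (Icc 0 t₁) t' 1) :=
        congr($this 1)
      rw [this]
      apply (ContinuousLinearMap.le_opENorm _ _).trans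
      gcongr
      exact (hu _ (t₁_mem ht')).le
    _ = C * pathELength (𝓡 d) γ 0 t₁ := by
      rw [lintegral_const_mul' _ _ ENNReal.coe_ne_top, pathELength_eq_lintegral_mfderivWithin_Icc]
    _ ≤ C * pathELength (𝓡 d) γ 0 1 := by gcongr
    _ < C * (ρ / C) := by
      gcongr
      exact ENNReal.coe_ne_top
    _ = ρ := ENNReal.mul_div_cancel (by simpa using C_pos.ne') ENNReal.coe_ne_top
  let A := γ ⁻¹' u
  have zero_mem : 0 ∈ A := by simpa [hγx, A] using hxu
  have A_closed : IsClosed (A ∩ Icc 0 1) :=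
    (u_closed.preimage γ_smooth.continuous).inter isClosed_Icc
  have hA : Icc 0 1 ⊆ A := by
    apply A_closed.Icc_subset_of_forall_mem_nhdsGT_of_Icc_subset zero_mem
    rintro t₁ ⟨ht₁0, ht₁1⟩ t₁_mem
    suffices γ t₁ ∈ v from
      γ_smooth.continuous.continuousWithinAt <| mem_of_superset (v_open.mem_nhds this) hv
    have hlt := key t₁ ht₁0 ht₁1.le t₁_mem
    have : γ' t₁ ∈ (extChartAt (𝓡 d) z).symm ⁻¹' v := by
      apply hr
      rw [← edist_eq_enorm_sub] at hlt
      have h1 : dist (γ' t₁) (γ' 0) < r / 2 := by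
        have h2 : edist (γ' t₁) (γ' 0) < (r / 2 : ℝ≥0) := hlt.trans_le (by exact_mod_cast hρ)
        rw [edist_nndist, ENNReal.coe_lt_coe] at h2
        exact_mod_cast h2
      have h0 : γ' 0 = extChartAt (𝓡 d) z x := by simp [γ', hγx]
      rw [h0] at h1
      have := dist_triangle (γ' t₁) (extChartAt (𝓡 d) z x) (extChartAt (𝓡 d) z z)
      rw [mem_ball] at hxb ⊢
      linarith
    have h := mem_preimage.1 this
    simpa only [Function.comp_apply, γ', (extChartAt (𝓡 d) z).left_inv <| uc <| t₁_mem
      (right_mem_Icc.mpr ht₁0)] using h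
  have h1 : (1 : ℝ) ∈ A := hA ⟨zero_le_one, le_rfl⟩
  refine ⟨us (by simpa [A, hγy] using h1), ?_⟩
  have := key 1 zero_le_one le_rfl hA
  rw [← edist_eq_enorm_sub, edist_comm] at this
  simpa [γ', hγx, hγy] using this

/-- `exists_edist_extChartAt_lt` in an arbitrary chart. -/
theorem exists_edist_chart_lt [RegularSpace M]
    {e : OpenPartialHomeomorph M (EuclideanSpace ℝ (Fin d))}
    (he : e ∈ IsManifold.maximalAtlas (𝓡 d) ∞ M) {z : M} (hz : z ∈ e.source) {s : Set M}
    (hs : s ∈ 𝓝 z) : ∃ c : ℝ≥0, 0 < c ∧ ∀ᶠ x in 𝓝 z, ∀ y, ∀ ε : ℝ≥0, ε ≤ 1 →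
      riemannianEDist (𝓡 d) x y < c * ε → y ∈ s ∧ edist (e x) (e y) < ε := by
  let ψ := extChartAt (𝓡 d) z
  have hg : ContDiffAt ℝ 1 (e ∘ ψ.symm) (ψ z) := by
    rw [← contMDiffAt_iff_contDiffAt]
    have h1 : ContMDiffAt (𝓡 d) (𝓡 d) 1 e (ψ.symm (ψ z)) := by
      rw [extChartAt_to_inv]
      exact (contMDiffAt_of_mem_maximalAtlas he hz).of_le (by exact_mod_cast le_top)
    refine h1.comp (ψ z) ?_
    have h2 := contMDiffOn_extChartAt_symm (I := 𝓡 d) (n := ∞) z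
    exact (h2.contMDiffAt ((isOpen_extChartAt_target z).mem_nhds
      (mem_extChartAt_target z))).of_le (by exact_mod_cast le_top)
  obtain ⟨K, t, ht, hK⟩ := hg.exists_lipschitzOnWith
  have hs' : s ∩ (ψ ⁻¹' t ∩ ψ.source) ∈ 𝓝 z :=
    inter_mem hs (inter_mem ((continuousAt_extChartAt z).preimage_mem_nhds ht)
      (extChartAt_source_mem_nhds z))
  obtain ⟨C, hC, r, hr, hlt⟩ := exists_edist_extChartAt_lt (d := d) z hs'
  let a : ℝ≥0 := min r (K + 1)⁻¹
  have ha : 0 < a := lt_min hr (by positivity)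
  refine ⟨a / C, by positivity, ?_⟩
  filter_upwards [hlt, hs'] with x hx hxs y ε hε hy
  have hε0 : 0 < ε := by
    rcases eq_or_lt_of_le (zero_le (a := ε)) with h | h
    · simp [← h] at hy
    · exact h
  obtain ⟨hys, hxy⟩ := hx y (a * ε) ((mul_le_of_le_one_right' hε).trans (min_le_left _ _)) (by
    refine hy.trans_eq ?_
    rw [← ENNReal.coe_div hC.ne', ← ENNReal.coe_mul]
    congr 1
    ring)
  refine ⟨hys.1, ?_⟩
  have h := hK hxs.2.1 hys.2.1
  simp only [Function.comp_apply, ψ.left_inv hxs.2.2, ψ.left_inv hys.2.2] at h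
  refine h.trans_lt ?_
  calc (K : ℝ≥0∞) * edist (ψ x) (ψ y) ≤ K * ((a * ε : ℝ≥0) : ℝ≥0∞) := by gcongr
    _ = ((K * (a * ε) : ℝ≥0) : ℝ≥0∞) := by norm_cast
    _ < ε := by
      rw [ENNReal.coe_lt_coe, ← mul_assoc]
      refine mul_lt_of_lt_one_left hε0 ?_
      calc K * a ≤ K * (K + 1)⁻¹ := by gcongr; exact min_le_right _ _
        _ < 1 := by
          rw [← div_eq_mul_inv, div_lt_one (by positivity)]
          exact lt_add_one K

/-- On the support of the cutoff function, the Riemannian distance to `X` is at least a constant times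
the minimum of `1` and of the distance to the trace of `X` in the chart: a path shorter than this
neither leaves the compact set of `Q` nor reaches the trace. -/
theorem ChartCutoff.exists_le_riemannianSetEDist [RegularSpace M] (Q : ChartCutoff d M)
    (X : Closeds M) : ∃ c : ℝ≥0, 0 < c ∧ ∀ (A : Set M) (ε : ℝ≥0), ε ≤ 1 → A ⊆ tsupport Q.cutoff →
      (∀ x ∈ A, Q.chart x ∉ thickening ε (Q.trace X)) → c * ε ≤ riemannianSetEDist d A X := by
  have hQ : IsCompact (tsupport Q.cutoff) := Q.isCompact_tsupport
  have hloc : ∃ c : ℝ≥0, 0 < c ∧ ∀ x ∈ tsupport Q.cutoff, ∀ y, ∀ ε : ℝ≥0, ε ≤ 1 →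
      riemannianEDist (𝓡 d) x y < c * ε → y ∈ Q.points ∧ edist (Q.chart x) (Q.chart y) < ε := by
    refine hQ.induction_on (p := fun A => ∃ c : ℝ≥0, 0 < c ∧ ∀ x ∈ A, ∀ y, ∀ ε : ℝ≥0, ε ≤ 1 →
      riemannianEDist (𝓡 d) x y < c * ε → y ∈ Q.points ∧ edist (Q.chart x) (Q.chart y) < ε)
      ⟨1, one_pos, by simp⟩ ?_ ?_ fun z hz => ?_
    · rintro A B hAB ⟨c, hc, h⟩
      exact ⟨c, hc, fun x hx => h x (hAB hx)⟩
    · rintro A B ⟨c, hc, h⟩ ⟨c', hc', h'⟩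
      refine ⟨min c c', lt_min hc hc', fun x hx y ε hε hy => ?_⟩
      rcases hx with hx | hx
      · exact h x hx y ε hε (hy.trans_le (by gcongr; exact min_le_left _ _))
      · exact h' x hx y ε hε (hy.trans_le (by gcongr; exact min_le_right _ _))
    · have hzs := Q.tsupport_subset_source hz
      have hcar : Q.carrier ∈ 𝓝 (Q.chart z) := mem_of_superset
        (closedBall_mem_nhds _ Q.radius_pos) ((closedBall_subset_cthickening
          (mem_image_of_mem _ hz) _).trans Q.cthickening_subset)
      have hpts : Q.points ∈ 𝓝 z := by
        filter_upwards [Q.chart.open_source.mem_nhds hzs, Q.chart.continuousAt hzs hcar] with x h h'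
        exact ChartCompact.mem_points.2 ⟨h, h'⟩
      obtain ⟨c, hc, h⟩ := exists_edist_chart_lt Q.mem_maximalAtlas hzs hpts
      exact ⟨_, mem_nhdsWithin_of_mem_nhds h, c, hc, fun x hx => hx⟩
  obtain ⟨c, hc, h⟩ := hloc
  refine ⟨c, hc, fun A ε hε hA hAX => ?_⟩
  refine le_iInf₂ fun x hx => le_iInf₂ fun y hy => ?_
  by_contra! hlt
  obtain ⟨hyQ, hxy⟩ := h x (hA hx) y ε hε hlt
  refine hAX x hx ((mem_thickening_iff_exists_edist_lt _ _).2 ⟨Q.chart y, ⟨y, ⟨hy, hyQ⟩, rfl⟩, ?_⟩)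
  simpa using hxy

end Riemannian

/-! ### Moderate growth and extension -/

section Dyadic

open Metric

/-- A sequence that is halved at each step. -/
theorem exists_dyadic_sequence {r : ℝ} (hr : 0 < r) : ∃ δ : ℕ → ℝ, (∀ n, 0 < δ n) ∧
    (∀ n, 2 * δ n ≤ r) ∧ (∀ n, δ (n + 1) = δ n / 2) ∧
    (∀ N, ∑ n ∈ Finset.range N, δ n ≤ r) ∧ ∀ ε > 0, ∃ N, δ N ≤ ε := by
  refine ⟨fun n => r / 2 * (1 / 2) ^ n, fun n => by positivity, fun n => ?_, fun n => ?_,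
    fun N => ?_, fun ε hε => ?_⟩
  · have : (1 / 2 : ℝ) ^ n ≤ 1 := pow_le_one₀ (by norm_num) (by norm_num)
    nlinarith
  · simp only [pow_succ]
    ring
  · have h : ∑ n ∈ Finset.range N, (1 / 2 : ℝ) ^ n = 2 * (1 - (1 / 2) ^ N) := by
      rw [geom_sum_eq (by norm_num) N]
      ring
    have : (0 : ℝ) < (1 / 2) ^ N := by positivity
    rw [← Finset.mul_sum, h]
    nlinarith
  · obtain ⟨N, hN⟩ := exists_pow_lt_of_lt_one (div_pos hε hr) (by norm_num : (1 / 2 : ℝ) < 1)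
    refine ⟨N, ?_⟩
    rw [lt_div_iff₀ hr] at hN
    have : (0 : ℝ) < (1 / 2) ^ N := by positivity
    simp only
    nlinarith

/-- Cutoff functions around `F` at dyadic scales `δ n`; the differences of consecutive ones have
derivatives of order `i` bounded by `B (δ n)⁻ⁱ`. -/
theorem exists_dyadic_cutoff (d k : ℕ) : ∃ B : ℝ, 0 ≤ B ∧
    ∀ (F : Set (EuclideanSpace ℝ (Fin d))) (δ : ℕ → ℝ), (∀ n, 0 < δ n) →
      (∀ n, δ (n + 1) = δ n / 2) → ∃ b : ℕ → EuclideanSpace ℝ (Fin d) → ℂ,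
        (∀ n, ContDiff ℝ ∞ (b n)) ∧ (∀ n, ∀ y ∈ cthickening (δ n / 4) F, b n y = 0) ∧
        (∀ n, ∀ y ∉ cthickening (δ n) F, b n y = 1) ∧ ∀ n, ∀ i ≤ k, ∀ y,
          ‖iteratedFDeriv ℝ i (fun y => b (n + 1) y - b n y) y‖ ≤ B * (δ n)⁻¹ ^ i := by
  obtain ⟨C, hC⟩ := exists_cutoff d
  have hC0 : ∀ i, 0 ≤ C i := fun i => by
    obtain ⟨b, -, -, -, hb⟩ := hC ∅ 1 one_pos
    simpa using (norm_nonneg _).trans (hb i 0)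
  have hpos : ∀ i, 0 ≤ C i * (2 ^ i + 1) := fun i => mul_nonneg (hC0 i) (by positivity)
  refine ⟨∑ i ∈ Finset.range (k + 1), C i * (2 ^ i + 1), Finset.sum_nonneg fun i _ => hpos i,
    fun F δ hδ0 hδs => ?_⟩
  choose b hb hb0 hb1 hbC using fun n => hC F (δ n) (hδ0 n)
  refine ⟨b, hb, hb0, hb1, fun n i hi y => ?_⟩
  have hsub : iteratedFDeriv ℝ i (fun y => b (n + 1) y - b n y) y =
      iteratedFDeriv ℝ i (b (n + 1)) y - iteratedFDeriv ℝ i (b n) y :=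
    iteratedFDeriv_sub_apply ((hb _).contDiffAt.of_le (by exact_mod_cast le_top))
      ((hb _).contDiffAt.of_le (by exact_mod_cast le_top))
  rw [hsub]
  refine (norm_sub_le _ _).trans ((add_le_add (hbC (n + 1) i y) (hbC n i y)).trans ?_)
  have h2 : (δ (n + 1))⁻¹ ^ i = 2 ^ i * (δ n)⁻¹ ^ i := by
    rw [hδs, ← mul_pow, inv_div, div_eq_mul_inv]
  rw [h2]
  calc C i * (2 ^ i * (δ n)⁻¹ ^ i) + C i * (δ n)⁻¹ ^ i
      = C i * (2 ^ i + 1) * (δ n)⁻¹ ^ i := by ring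
    _ ≤ (∑ i ∈ Finset.range (k + 1), C i * (2 ^ i + 1)) * (δ n)⁻¹ ^ i := by
      have := hδ0 n
      gcongr
      exact Finset.single_le_sum (f := fun i => C i * (2 ^ i + 1))
        (fun i _ => hpos i) (Finset.mem_range_succ_iff.2 hi)

end Dyadic

section Growth

variable {d : ℕ} {M : Type*} [TopologicalSpace M] [ChartedSpace (EuclideanSpace ℝ (Fin d)) M]

open Metric

/-- If `η` vanishes on an open set, then the support of its product with the cutoff function and
`f` does not meet this set in the chart. -/
theorem ChartCutoff.notMem_of_mem_tsupport (Q : ChartCutoff d M)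
    {η : EuclideanSpace ℝ (Fin d) → ℂ} (hη : ContDiff ℝ ∞ η) {O : Set (EuclideanSpace ℝ (Fin d))}
    (hO : IsOpen O) (h0 : ∀ y ∈ O, η y = 0) (f : SmoothFunction d M) {x : M}
    (hx : x ∈ tsupport (Q.mulComp η hη * f : SmoothFunction d M)) : Q.chart x ∉ O := fun hxO => by
  have hxs := Q.tsupport_subset_source (Q.tsupport_mulComp_mul_subset η hη f hx)
  refine notMem_tsupport_iff_eventuallyEq.2 ?_ hx
  filter_upwards [Q.chart.continuousAt hxs (hO.mem_nhds hxO)] with y hy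
  rw [SmoothFunction.mul_apply, Q.mulComp_apply, h0 _ hy, mul_zero, zero_mul, Pi.zero_apply]

/-- For `f` that vanishes near `X`, the product of `f` with the cutoff function does not change if it
is multiplied by a function that is `1` away from a small neighbourhood of the trace of `X`. -/
theorem ChartCutoff.exists_mulComp_mul_eq [T2Space M] (Q : ChartCutoff d M) {X : Closeds M}
    {f : SmoothFunction d M} (hf : VanishesNear f X) :
    ∃ ε : ℝ, 0 < ε ∧ ∀ (η : EuclideanSpace ℝ (Fin d) → ℂ) (hη : ContDiff ℝ ∞ η),
      (∀ y ∉ cthickening ε (Q.trace X), η y = 1) → Q.mulComp η hη * f = Q.cutoff * f := by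
  let Z := Q.chart '' (tsupport Q.cutoff ∩ tsupport f)
  have hZ : IsCompact Z :=
    (Q.isCompact_tsupport.inter_right (isClosed_tsupport _)).image_of_continuousOn
      (Q.chart.continuousOn.mono fun x hx => Q.tsupport_subset_source hx.1)
  have hZX : Q.trace X ⊆ Zᶜ := by
    rintro _ ⟨x, ⟨hxX, hxQ⟩, rfl⟩ ⟨y, ⟨hyQ, hyf⟩, hxy⟩
    rw [Q.chart.injOn (Q.tsupport_subset_source hyQ) (ChartCompact.mem_points.1 hxQ).1 hxy] at hyf
    exact hf.tsupport_subset hyf hxX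
  obtain ⟨ε, hε, hεZ⟩ := (Q.isCompact_trace X).exists_cthickening_subset_open
    hZ.isClosed.isOpen_compl hZX
  refine ⟨ε, hε, fun η hη h1 => SmoothFunction.ext fun x => ?_⟩
  rw [SmoothFunction.mul_apply, SmoothFunction.mul_apply, Q.mulComp_apply]
  by_cases hxQ : x ∈ tsupport Q.cutoff
  · by_cases hxf : x ∈ tsupport f
    · rw [h1 _ fun h => hεZ h ⟨x, ⟨hxQ, hxf⟩, rfl⟩, mul_one]
    · rw [image_eq_zero_of_notMem_tsupport hxf, mul_zero, mul_zero]
  · rw [image_eq_zero_of_notMem_tsupport hxQ, zero_mul]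

/-- Multiplication by a function with compact support, from the functions that vanish near `X` to
the test functions on `M ∖ X`. -/
def mulVanishing {X : Closeds M} (g : SmoothFunction d M) (hg : HasCompactSupport g) :
    vanishingNear d X →ₗ[ℂ] testFunctions d X.compl :=
  (LinearMap.mulLeft ℂ g).restrict fun _ hf =>
    ⟨HasCompactSupport.mul_right hg, (VanishesNear.mul_right hf g).tsupport_subset⟩

theorem coe_mulVanishing {X : Closeds M} (g : SmoothFunction d M) (hg : HasCompactSupport g)
    (f : vanishingNear d X) :
    (mulVanishing g hg f : SmoothFunction d M) = g * (f : SmoothFunction d M) := rfl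

/-- Finitely many cells of the same level cover a given compact set. -/
theorem ChartFamily.exists_subset_iUnion_points {ι : Type*} (𝒜 : ChartFamily d M ι) {K : Set M}
    (hK : IsCompact K) : ∃ (l : ℕ) (S : Finset ι), K ⊆ ⋃ α ∈ S, (𝒜.cell α l).points := by
  classical
  have hmono : ∀ α, Monotone fun l => (𝒜.cell α l).carrier := fun α =>
    monotone_nat_of_le_succ fun l => (𝒜.subset_interior α l).trans interior_subset
  obtain ⟨T, hT⟩ := hK.elim_finite_subcover
    (fun p : ι × ℕ => (𝒜.chart p.1).source ∩ 𝒜.chart p.1 ⁻¹' interior (𝒜.cell p.1 p.2).carrier)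
    (fun p => (𝒜.chart p.1).isOpen_inter_preimage isOpen_interior) fun x _ => by
      obtain ⟨α, hα⟩ := mem_iUnion.1 (𝒜.iUnion_source.symm.subset (mem_univ x))
      obtain ⟨l, hl⟩ := mem_iUnion.1 ((𝒜.iUnion_cell α).symm.subset ((𝒜.chart α).map_source hα))
      exact mem_iUnion.2 ⟨(α, l + 1), hα, 𝒜.subset_interior α l hl⟩
  refine ⟨T.sup Prod.snd, T.image Prod.fst, fun x hx => ?_⟩
  obtain ⟨p, hp, hxp, hxp'⟩ := mem_iUnion₂.1 (hT hx)
  refine mem_iUnion₂.2 ⟨p.1, Finset.mem_image_of_mem _ hp, ChartCompact.mem_points.2 ?_⟩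
  rw [𝒜.chart_cell]
  exact ⟨hxp, hmono p.1 (Finset.le_sup (f := Prod.snd) hp) (interior_subset hxp')⟩

variable [IsManifold (𝓡 d) ∞ M]

section

variable [RiemannianBundle (fun x : M => TangentSpace (𝓡 d) x)]

/-- The restriction of a distribution on `M` grows moderately, with exponent `s = 0`. -/
theorem MDistribution.Extends.hasModerateGrowth [T2Space M] {ι : Type*} (𝒜 : ChartFamily d M ι)
    {X : Closeds M} {t : MDistribution d X.compl} {u : MDistribution d (⊤ : Opens M)}
    (hu : u.Extends t) : HasModerateGrowth 𝒜 t := by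
  intro K hK
  obtain ⟨l, S, hS⟩ := 𝒜.exists_subset_iUnion_points hK
  obtain ⟨k, C, hC0, hC⟩ := u.exists_norm_le (fun α => 𝒜.cell α l) S hK (fun _ _ => trivial) hS
  refine ⟨k, l, S, C.toNNReal, 0, fun φ hφ => ?_⟩
  rw [← hu φ]
  refine (ENNReal.ofReal_le_ofReal (hC _ hφ)).trans ?_
  rw [ENNReal.ofReal_mul hC0]
  exact mul_le_mul_left (le_mul_of_one_le_right' le_self_add) _

variable [IsContinuousRiemannianBundle (EuclideanSpace ℝ (Fin d))
  (fun x : M => TangentSpace (𝓡 d) x)]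

/-- Moderate growth, in terms of the distance to `X` in a chart. -/
theorem HasModerateGrowth.exists_norm_le [T2Space M] [RegularSpace M] {ι : Type*}
    {𝒜 : ChartFamily d M ι} {X : Closeds M} {t : MDistribution d X.compl}
    (ht : HasModerateGrowth 𝒜 t) (Q : ChartCutoff d M) :
    ∃ (k s : ℕ) (C : ℝ), 0 ≤ C ∧ ∀ δ : ℝ, 0 < δ → δ ≤ 1 → ∀ φ : testFunctions d X.compl,
      tsupport (φ : SmoothFunction d M) ⊆ tsupport Q.cutoff →
      (∀ x ∈ tsupport (φ : SmoothFunction d M), Q.chart x ∉ thickening δ (Q.trace X)) →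
        ‖t φ‖ ≤ C * δ⁻¹ ^ s * chartSeminorm Q.toChartCompact k (φ : SmoothFunction d M) := by
  obtain ⟨k, l, S, C, s, h⟩ := ht _ Q.isCompact_tsupport
  obtain ⟨c, hc, hdist⟩ := Q.exists_le_riemannianSetEDist X
  choose D hD0 hD using fun α => exists_chartSeminorm_le (𝒜.cell α l) Q.toChartCompact k
  have hsum : 0 ≤ ∑ α ∈ S, D α := Finset.sum_nonneg fun α _ => hD0 α
  refine ⟨k, ⌈s⌉₊, C * (1 + c ^ (-(s : ℝ)) : ℝ≥0) * ∑ α ∈ S, D α, by positivity,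
    fun δ hδ hδ1 φ hφ hφX => ?_⟩
  lift δ to ℝ≥0 using hδ.le
  have hδ : 0 < δ := by exact_mod_cast hδ
  have hδ1 : δ ≤ 1 := by exact_mod_cast hδ1
  have hp : (S.sup fun α => chartSeminorm (𝒜.cell α l) k) (φ : SmoothFunction d M) ≤
      (∑ α ∈ S, D α) * chartSeminorm Q.toChartCompact k (φ : SmoothFunction d M) := by
    refine Seminorm.finset_sup_apply_le (mul_nonneg hsum (apply_nonneg _ _)) fun α hα => ?_
    refine (hD α φ (hφ.trans Q.tsupport_subset)).trans ?_
    gcongr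
    exact Finset.single_le_sum (fun α _ => hD0 α) hα
  have hone : 1 ≤ δ⁻¹ := (one_le_inv₀ hδ).2 hδ1
  have hd : riemannianSetEDist d (tsupport (φ : SmoothFunction d M)) X ^ (-(s : ℝ)) ≤
      ((c ^ (-(s : ℝ)) * δ⁻¹ ^ ⌈s⌉₊ : ℝ≥0) : ℝ≥0∞) := by
    have h1 := hdist _ δ hδ1 hφ hφX
    rw [ENNReal.rpow_neg]
    refine (ENNReal.inv_le_inv.2 (ENNReal.rpow_le_rpow h1 s.2)).trans ?_
    rw [← ENNReal.rpow_neg]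
    rw [← ENNReal.coe_mul, ← ENNReal.coe_rpow_of_ne_zero (mul_pos hc hδ).ne', NNReal.mul_rpow]
    rw [ENNReal.coe_le_coe]
    refine mul_le_mul_right ?_ _
    rw [NNReal.rpow_neg, ← NNReal.inv_rpow, ← NNReal.rpow_natCast]
    exact NNReal.rpow_le_rpow_of_exponent_le hone (by exact_mod_cast Nat.le_ceil s)
  have hd' : 1 + riemannianSetEDist d (tsupport (φ : SmoothFunction d M)) X ^ (-(s : ℝ)) ≤
      (((1 + c ^ (-(s : ℝ))) * δ⁻¹ ^ ⌈s⌉₊ : ℝ≥0) : ℝ≥0∞) := by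
    rw [add_mul, one_mul, ENNReal.coe_add]
    gcongr
    exact_mod_cast one_le_pow₀ hone
  have hfin := (h φ hφ).trans (mul_le_mul' (mul_le_mul_right hd' _)
    (ENNReal.ofReal_le_ofReal hp))
  rw [← ENNReal.coe_mul, ← ENNReal.ofReal_coe_nnreal, ← ENNReal.ofReal_mul (by positivity),
    ENNReal.ofReal_le_ofReal_iff (by positivity)] at hfin
  refine hfin.trans_eq ?_
  push_cast
  ring

/-- Moderate growth for products with a function `η` that vanishes at distance less than `δ` from
the trace of `X`. -/
theorem HasModerateGrowth.exists_norm_mulComp_le [T2Space M] [RegularSpace M] {ι : Type*}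
    {𝒜 : ChartFamily d M ι} {X : Closeds M} {t : MDistribution d X.compl}
    (ht : HasModerateGrowth 𝒜 t) (Q : ChartCutoff d M) :
    ∃ (k s : ℕ) (C : ℝ), 0 ≤ C ∧ ∀ δ : ℝ, 0 < δ → δ ≤ 1 →
      ∀ (η : EuclideanSpace ℝ (Fin d) → ℂ) (hη : ContDiff ℝ ∞ η),
        (∀ y ∈ cthickening δ (Q.trace X), η y = 0) → ∀ f : vanishingNear d X,
          ‖t (mulVanishing (Q.mulComp η hη) (Q.isCompact_tsupport_mulComp η hη) f)‖ ≤
            C * δ⁻¹ ^ s * chartSeminorm Q.toChartCompact k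
              (Q.mulComp η hη * (f : SmoothFunction d M)) := by
  obtain ⟨k, s, C, hC0, hC⟩ := ht.exists_norm_le Q
  refine ⟨k, s, C, hC0, fun δ hδ hδ1 η hη h0 f => ?_⟩
  refine hC δ hδ hδ1 _ ?_ ?_
  · rw [coe_mulVanishing]
    exact Q.tsupport_mulComp_mul_subset η hη _
  · rw [coe_mulVanishing]
    exact fun x hx => Q.notMem_of_mem_tsupport hη isOpen_thickening
      (fun y hy => h0 y (thickening_subset_cthickening _ _ hy)) _ hx

/-- **Dyadic summation.** If `t` has moderate growth, then `f ↦ t (χ f)` is bounded on the functions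
that vanish near `X`. Indeed, `χ f` is cut into pieces at distance `δₙ = 2⁻ⁿ δ₀` from `X`, where
the growth of `t` is compensated by the flatness of `f`. -/
theorem HasModerateGrowth.exists_norm_mulVanishing_le [T2Space M] [RegularSpace M] {ι : Type*}
    {𝒜 : ChartFamily d M ι} {X : Closeds M} {t : MDistribution d X.compl}
    (ht : HasModerateGrowth 𝒜 t) (Q : ChartCutoff d M) :
    ∃ (m : ℕ) (C : ℝ), 0 ≤ C ∧ ∀ f : vanishingNear d X,
      ‖t (mulVanishing Q.cutoff Q.isCompact_tsupport f)‖ ≤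
        C * chartSeminorm Q.toChartCompact m (f : SmoothFunction d M) := by
  obtain ⟨k, s, C, hC0, hC⟩ := ht.exists_norm_mulComp_le Q
  obtain ⟨B, hB0, hB⟩ := exists_dyadic_cutoff d k
  obtain ⟨δ, hδ0, hδr, hδs, hδsum, hδlim⟩ := exists_dyadic_sequence Q.radius_pos
  have hr1 := Q.radius_le_one
  have hδ1 : ∀ n, δ n ≤ 1 := fun n => by linarith [hδr n, hδ0 n]
  obtain ⟨b, hb, hb0, hb1, hbB⟩ := hB (Q.trace X) δ hδ0 hδs
  obtain ⟨A, hA0, hA⟩ := Q.exists_chartSeminorm_mulComp_le X (k := k) (m := k + s + 1) (by omega) hB0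
  obtain ⟨A₀, hA₀0, hA₀⟩ := exists_chartSeminorm_mul_le Q.toChartCompact (Q.mulComp (b 0) (hb 0)) k
  have hbs : ∀ n, ContDiff ℝ ∞ fun y => b (n + 1) y - b n y := fun n => (hb _).sub (hb _)
  have hδ4 : ∀ n, 0 < δ n / 4 ∧ δ n / 4 ≤ 1 := fun n =>
    ⟨by linarith [hδ0 n], by linarith [hδ0 n, hδ1 n]⟩
  refine ⟨k + s + 1, C * (δ 0 / 4)⁻¹ ^ s * A₀ + C * A * 8 ^ s, by
    have := hδ0 0
    positivity, fun f => ?_⟩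
  let p := chartSeminorm Q.toChartCompact (k + s + 1) (f : SmoothFunction d M)
  have hp : 0 ≤ p := apply_nonneg _ _
  let T : ℕ → ℂ := fun n => t (mulVanishing (Q.mulComp (b n) (hb n))
    (Q.isCompact_tsupport_mulComp _ _) f)
  have hT0 : ‖T 0‖ ≤ C * (δ 0 / 4)⁻¹ ^ s * A₀ * p := by
    refine (hC (δ 0 / 4) (hδ4 0).1 (hδ4 0).2 _ (hb 0) (hb0 0) f).trans ?_
    rw [mul_assoc (C * _)]
    have := (hδ4 0).1
    refine mul_le_mul_of_nonneg_left ((hA₀ _).trans ?_) (by positivity)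
    exact mul_le_mul_of_nonneg_left (chartSeminorm_mono _ (by omega) _) hA₀0
  have hstep : ∀ n, ‖T (n + 1) - T n‖ ≤ C * A * 8 ^ s * p * δ n := by
    intro n
    have hδn := hδ0 n
    let ψ := mulVanishing (X := X) (Q.mulComp _ (hbs n)) (Q.isCompact_tsupport_mulComp _ _) f
    have hT : T (n + 1) - T n = t ψ := by
      refine (map_sub t.toLinearMap _ _).symm.trans (congrArg t.toLinearMap ?_)
      refine Subtype.ext (SmoothFunction.ext fun x => ?_)
      change Q.cutoff x * b (n + 1) (Q.chart x) * f.1 x - Q.cutoff x * b n (Q.chart x) * f.1 x =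
        Q.cutoff x * (b (n + 1) (Q.chart x) - b n (Q.chart x)) * f.1 x
      ring
    have hzero : ∀ y ∈ cthickening (δ (n + 1) / 4) (Q.trace X), b (n + 1) y - b n y = 0 :=
      fun y hy => by
        rw [hb0 (n + 1) y hy, hb0 n y (cthickening_mono (by rw [hδs]; linarith) _ hy), sub_zero]
    have hout : ∀ y ∉ cthickening (δ n) (Q.trace X), b (n + 1) y - b n y = 0 := fun y hy => by
      rw [hb1 n y hy, hb1 (n + 1) y fun h => hy (cthickening_mono (by rw [hδs]; linarith) _ h),
        sub_self]
    rw [hT]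
    refine (hC (δ (n + 1) / 4) (hδ4 _).1 (hδ4 _).2 _ (hbs n) hzero f).trans ?_
    have hm := hA (δ n) hδn (hδr n) _ (hbs n) (hbB n) hout f f.2
    have e1 : k + s + 1 - k = s + 1 := by omega
    rw [e1] at hm
    have e2 : (δ (n + 1) / 4)⁻¹ ^ s = 8 ^ s * (δ n)⁻¹ ^ s := by
      rw [hδs, ← mul_pow]
      congr 1
      field_simp
      norm_num
    rw [e2]
    calc C * (8 ^ s * (δ n)⁻¹ ^ s) * chartSeminorm Q.toChartCompact k
          (Q.mulComp _ (hbs n) * (f : SmoothFunction d M))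
        ≤ C * (8 ^ s * (δ n)⁻¹ ^ s) * (A * δ n ^ (s + 1) * p) :=
          mul_le_mul_of_nonneg_left hm (by positivity)
      _ = C * A * 8 ^ s * p * δ n := by
        rw [pow_succ, inv_pow]
        field_simp
  have hTN : ∀ N, ‖T N‖ ≤ (C * (δ 0 / 4)⁻¹ ^ s * A₀ + C * A * 8 ^ s) * p := fun N => by
    have h1 : T N = T 0 + ∑ n ∈ Finset.range N, (T (n + 1) - T n) := by
      rw [Finset.sum_range_sub, add_sub_cancel]
    rw [h1, add_mul]
    refine (norm_add_le _ _).trans (add_le_add hT0 ((norm_sum_le _ _).trans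
      ((Finset.sum_le_sum fun n _ => hstep n).trans ?_)))
    rw [← Finset.mul_sum]
    exact mul_le_of_le_one_right (by positivity) ((hδsum N).trans hr1)
  -- Since `f` vanishes near `X`, for large `N` the cutoff `b N` does not change `χ f`.
  obtain ⟨ε, hε, hεf⟩ := Q.exists_mulComp_mul_eq f.2
  obtain ⟨N, hN⟩ := hδlim ε hε
  have hf : mulVanishing Q.cutoff Q.isCompact_tsupport f =
      mulVanishing (X := X) (Q.mulComp (b N) (hb N)) (Q.isCompact_tsupport_mulComp _ _) f :=
    Subtype.ext (hεf (b N) (hb N) fun y hy => hb1 N y fun h => hy (cthickening_mono hN _ h)).symm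
  rw [hf]
  exact hTN N

/-- A distribution of moderate growth is extendible: extend each of the pieces `f ↦ t (χᵢ f)`, for a
partition of unity `χᵢ`, by the theorem of Hahn and Banach, and add the results. -/
theorem HasModerateGrowth.exists_extends [T2Space M] [ParacompactSpace M] {ι : Type*}
    {𝒜 : ChartFamily d M ι} {X : Closeds M} {t : MDistribution d X.compl}
    (ht : HasModerateGrowth 𝒜 t) : ∃ u : MDistribution d (⊤ : Opens M), u.Extends t := by
  obtain ⟨κ, Q, hQ, hQ1⟩ := exists_chartCutoff_partition d M
  choose m C hC0 hC using fun i => ht.exists_norm_mulVanishing_le (Q i)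
  have hext : ∀ i, ∃ w : SmoothFunction d M →ₗ[ℂ] ℂ,
      (∀ f : vanishingNear d X,
        w f = t (mulVanishing (Q i).cutoff (Q i).isCompact_tsupport f)) ∧
      ∀ f, ‖w f‖ ≤ C i * chartSeminorm (Q i).toChartCompact (m i) f := fun i => by
    have hCp : ∀ f, ((C i).toNNReal • chartSeminorm (Q i).toChartCompact (m i)) f =
        C i * chartSeminorm (Q i).toChartCompact (m i) f := fun f => by
      rw [smul_apply, NNReal.smul_def, Real.coe_toNNReal _ (hC0 i), smul_eq_mul]
    obtain ⟨w, hw, hwC⟩ := Module.Dual.exists_extension_of_le_seminorm (vanishingNear d X)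
      (t.toLinearMap ∘ₗ mulVanishing (Q i).cutoff (Q i).isCompact_tsupport)
      (p := (C i).toNNReal • chartSeminorm (Q i).toChartCompact (m i))
      fun f => (hC i f).trans_eq (hCp f).symm
    exact ⟨w, hw, fun f => (hwC f).trans_eq (hCp f)⟩
  choose w hw hwC using hext
  obtain ⟨u, hu⟩ := exists_locallyFinite_sum (L := fun i => (Q i).toChartCompact) hQ w m C hwC
  refine ⟨u, fun φ => ?_⟩
  obtain ⟨S, hS⟩ := exists_finset_disjoint (L := fun i => (Q i).toChartCompact) hQ φ.2.1
  rw [hu _ S hS]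
  let f : vanishingNear d X := ⟨φ, vanishesNear_of_tsupport_subset φ.2.2⟩
  have hφ : ∑ i ∈ S, mulVanishing (Q i).cutoff (Q i).isCompact_tsupport f = φ := by
    apply Subtype.ext
    rw [Submodule.coe_sum]
    exact sum_cutoff_mul_eq hQ1 hS
  conv_rhs => rw [← hφ, map_sum]
  exact Finset.sum_congr rfl fun i _ => hw i f

end

end Growth

/-! ### Extension by subtraction of distributions supported on `X` -/

section Subtraction

variable {d : ℕ} {M : Type*} [TopologicalSpace M] [ChartedSpace (EuclideanSpace ℝ (Fin d)) M]

open Metric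

/-- Multiplication by a function with compact support, from the smooth functions to the test
functions on `M`. -/
def mulCompact (g : SmoothFunction d M) (hg : HasCompactSupport g) :
    SmoothFunction d M →ₗ[ℂ] testFunctions d (⊤ : Opens M) :=
  (LinearMap.mulLeft ℂ g).codRestrict (testFunctions d ⊤) fun _ =>
    ⟨HasCompactSupport.mul_right hg, fun _ _ => trivial⟩

theorem coe_mulCompact (g : SmoothFunction d M) (hg : HasCompactSupport g)
    (f : SmoothFunction d M) : (mulCompact g hg f : SmoothFunction d M) = g * f := rfl

/-- The locally finite sum of smooth functions supported in the compact sets of a family. -/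
def locallyFiniteSmoothSum {κ : Type*} {Q : κ → ChartCutoff d M}
    (hQ : LocallyFinite fun i => (Q i).points) (g : κ → SmoothFunction d M)
    (hg : ∀ i, tsupport (g i) ⊆ (Q i).points) : SmoothFunction d M :=
  ⟨fun x => ∑ᶠ i, g i x, contMDiff_finsum (fun i => (g i).contMDiff)
    (hQ.subset fun i => (subset_tsupport _).trans (hg i))⟩

theorem locallyFiniteSmoothSum_apply {κ : Type*} {Q : κ → ChartCutoff d M}
    (hQ : LocallyFinite fun i => (Q i).points) (g : κ → SmoothFunction d M)
    (hg : ∀ i, tsupport (g i) ⊆ (Q i).points) {x : M} {S : Finset κ}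
    (hS : ∀ i ∉ S, x ∉ (Q i).points) :
    locallyFiniteSmoothSum hQ g hg x = ∑ i ∈ S, g i x :=
  finsum_eq_sum_of_support_subset _ fun i hi => by
    by_contra h
    exact hS i h (hg i (subset_tsupport _ hi))

variable [IsManifold (𝓡 d) ∞ M]

/-- A distribution on `M` is bounded on the functions supported in the support of the cutoff
function by a single seminorm. -/
theorem MDistribution.exists_norm_mulComp_le [T2Space M] (u : MDistribution d (⊤ : Opens M))
    (Q : ChartCutoff d M) : ∃ (k : ℕ) (C : ℝ), 0 ≤ C ∧
      ∀ (η : EuclideanSpace ℝ (Fin d) → ℂ) (hη : ContDiff ℝ ∞ η) (f : SmoothFunction d M),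
        ‖u (mulCompact (Q.mulComp η hη) (Q.isCompact_tsupport_mulComp η hη) f)‖ ≤
          C * chartSeminorm Q.toChartCompact k (Q.mulComp η hη * f) := by
  obtain ⟨k, C, hC0, hC⟩ := u.exists_norm_le (fun _ : Unit => Q.toChartCompact) {()}
    Q.isCompact_tsupport (fun _ _ => trivial)
    fun x hx => mem_iUnion₂.2 ⟨(), Finset.mem_singleton_self _, Q.tsupport_subset hx⟩
  rw [Finset.sup_singleton] at hC
  refine ⟨k, C, hC0, fun η hη f => hC _ ?_⟩
  rw [coe_mulCompact]
  exact Q.tsupport_mulComp_mul_subset η hη f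

/-- The filter of `HasSubtractedLimit` on `(0, 1]` is that of `λ → 0`. -/
theorem tendsto_coe_comap : Tendsto (fun r : Ioc (0 : ℝ) 1 => (r : ℝ))
    (comap Subtype.val (𝓝[>] (0 : ℝ))) (𝓝 0) :=
  tendsto_comap.mono_right nhdsWithin_le_nhds

/-- The contribution of one chart to the renormalization. With `b r` a cutoff at distance `r` from
`X`, the linear form `v r f = u (χ (1 - b r) f)` is `O(r)` on the functions that vanish near `X`.
By the theorem of Hahn and Banach there is `w r` of size `O(r)` on all of `𝓔(M)` that agrees with
`v r` on these functions. The difference `w r - v r` is then supported on `X`. -/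
theorem MDistribution.exists_local_subtraction [T2Space M] (u : MDistribution d (⊤ : Opens M))
    (X : Closeds M) (Q : ChartCutoff d M) :
    ∃ (b : Ioc (0 : ℝ) 1 → EuclideanSpace ℝ (Fin d) → ℂ) (hb : ∀ r, ContDiff ℝ ∞ (b r))
      (w : Ioc (0 : ℝ) 1 → SmoothFunction d M →ₗ[ℂ] ℂ) (m : ℕ) (C : ℝ)
      (D : Ioc (0 : ℝ) 1 → ℝ),
      (∀ r, VanishesNear (Q.mulComp (b r) (hb r)) X) ∧
      (∀ x ∉ X, ∀ᶠ r in comap Subtype.val (𝓝[>] (0 : ℝ)),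
        Q.mulComp (b r) (hb r) x = Q.cutoff x) ∧
      (∀ r, ∀ f ∈ vanishingNear d X, w r f = u (mulCompact (Q.mulComp (fun y => 1 - b r y)
        (contDiff_const.sub (hb r))) (Q.isCompact_tsupport_mulComp _ _) f)) ∧
      (∀ r f, ‖w r f‖ ≤ C * r * chartSeminorm Q.toChartCompact m f) ∧
      ∀ r f, ‖w r f - u (mulCompact (Q.mulComp (fun y => 1 - b r y)
        (contDiff_const.sub (hb r))) (Q.isCompact_tsupport_mulComp _ _) f)‖ ≤
          D r * chartSeminorm Q.toChartCompact m f := by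
  obtain ⟨k, C, hC0, hC⟩ := u.exists_norm_mulComp_le Q
  obtain ⟨Cb, hCb⟩ := exists_cutoff d
  have hr0 := Q.radius_pos
  have hr1 := Q.radius_le_one
  let δ : Ioc (0 : ℝ) 1 → ℝ := fun r => Q.radius / 2 * r
  have hδ0 : ∀ r, 0 < δ r := fun r => mul_pos (by positivity) r.2.1
  have hδ : ∀ r, 2 * δ r ≤ Q.radius := fun r => by
    have := r.2.2
    simp only [δ]
    nlinarith
  have hδr : ∀ r, δ r ≤ r := fun r => by
    have := r.2.1
    simp only [δ]
    nlinarith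
  have hδ1 : ∀ r, δ r ≤ 1 := fun r => (hδr r).trans r.2.2
  choose b hb hb0 hb1 hbC using fun r => hCb (Q.trace X) (δ r) (hδ0 r)
  have hbs : ∀ r, ContDiff ℝ ∞ fun y => 1 - b r y := fun r => contDiff_const.sub (hb r)
  have hCb0 : ∀ i, 0 ≤ Cb i := fun i => by
    obtain ⟨b, -, -, -, hb⟩ := hCb ∅ 1 one_pos
    simpa using (norm_nonneg _).trans (hb i 0)
  let B := 1 + ∑ i ∈ Finset.range (k + 1), Cb i
  have hB0 : 0 ≤ B := add_nonneg zero_le_one (Finset.sum_nonneg fun i _ => hCb0 i)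
  have hB : ∀ r, ∀ i ≤ k, ∀ y, ‖iteratedFDeriv ℝ i (fun y => 1 - b r y) y‖ ≤ B * (δ r)⁻¹ ^ i := by
    intro r i hi y
    have hsub : iteratedFDeriv ℝ i (fun y => 1 - b r y) y =
        iteratedFDeriv ℝ i (fun _ => (1 : ℂ)) y - iteratedFDeriv ℝ i (b r) y :=
      iteratedFDeriv_sub_apply contDiffAt_const
        ((hb _).contDiffAt.of_le (by exact_mod_cast le_top))
    have h1 : ‖iteratedFDeriv ℝ i (fun _ : EuclideanSpace ℝ (Fin d) => (1 : ℂ)) y‖ ≤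
        1 * (δ r)⁻¹ ^ i := by
      rcases i with _ | i
      · simp
      · rw [iteratedFDeriv_const_of_ne (by omega)]
        have := hδ0 r
        simpa using by positivity
    rw [hsub]
    refine (norm_sub_le _ _).trans ((add_le_add h1 (hbC r i y)).trans ?_)
    rw [← add_mul]
    have := hδ0 r
    gcongr
    exact add_le_add le_rfl (Finset.single_le_sum (fun i _ => hCb0 i) (Finset.mem_range_succ_iff.2 hi))
  obtain ⟨A, hA0, hA⟩ := Q.exists_chartSeminorm_mulComp_le X (k := k) (m := k + 1) (by omega) hB0
  choose A' hA'0 hA' using fun r =>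
    exists_chartSeminorm_mul_le Q.toChartCompact (Q.mulComp _ (hbs r)) k
  let v : Ioc (0 : ℝ) 1 → SmoothFunction d M →ₗ[ℂ] ℂ := fun r => u.toLinearMap ∘ₗ
    mulCompact (Q.mulComp _ (hbs r)) (Q.isCompact_tsupport_mulComp _ _)
  have hv : ∀ r f, ‖v r f‖ ≤ C * A' r * chartSeminorm Q.toChartCompact (k + 1) f := fun r f => by
    refine (hC _ (hbs r) f).trans ?_
    rw [mul_assoc]
    refine mul_le_mul_of_nonneg_left ((hA' r f).trans ?_) hC0
    exact mul_le_mul_of_nonneg_left (chartSeminorm_mono _ (by omega) _) (hA'0 r)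
  have hvX : ∀ r, ∀ f ∈ vanishingNear d X,
      ‖v r f‖ ≤ C * A * r * chartSeminorm Q.toChartCompact (k + 1) f := fun r f hf => by
    refine (hC _ (hbs r) f).trans ?_
    have h := hA (δ r) (hδ0 r) (hδ r) _ (hbs r) (hB r)
      (fun y hy => by rw [hb1 r y hy, sub_self]) f hf
    rw [add_tsub_cancel_left, pow_one] at h
    rw [mul_assoc, mul_assoc, ← mul_assoc A]
    refine mul_le_mul_of_nonneg_left (h.trans ?_) hC0
    exact mul_le_mul_of_nonneg_right (mul_le_mul_of_nonneg_left (hδr r) hA0) (apply_nonneg _ _)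
  have hext : ∀ r, ∃ w : SmoothFunction d M →ₗ[ℂ] ℂ, (∀ f ∈ vanishingNear d X, w f = v r f) ∧
      ∀ f, ‖w f‖ ≤ C * A * r * chartSeminorm Q.toChartCompact (k + 1) f := fun r => by
    have hnn : 0 ≤ C * A * (r : ℝ) := mul_nonneg (mul_nonneg hC0 hA0) r.2.1.le
    have hp : ∀ f, ((C * A * (r : ℝ)).toNNReal • chartSeminorm Q.toChartCompact (k + 1)) f =
        C * A * r * chartSeminorm Q.toChartCompact (k + 1) f := fun f => by
      rw [smul_apply, NNReal.smul_def, Real.coe_toNNReal _ hnn, smul_eq_mul]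
    obtain ⟨w, hw, hwC⟩ := Module.Dual.exists_extension_of_le_seminorm (vanishingNear d X)
      (v r ∘ₗ (vanishingNear d X).subtype)
      (p := (C * A * (r : ℝ)).toNNReal • chartSeminorm Q.toChartCompact (k + 1))
      fun f => (hvX r f f.2).trans_eq (hp f).symm
    exact ⟨w, fun f hf => hw ⟨f, hf⟩, fun f => (hwC f).trans_eq (hp f)⟩
  choose w hw hwC using hext
  refine ⟨b, hb, w, k + 1, C * A, fun r => C * A * r + C * A' r,
    fun r => Q.vanishesNear_mulComp (hb r) (by linarith [hδ0 r] : 0 < δ r / 4) (hb0 r),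
    fun x hx => ?_, hw, hwC, fun r f => ?_⟩
  · by_cases hxQ : x ∈ tsupport Q.cutoff
    · have hxF : Q.trace X ⊆ {Q.chart x}ᶜ := by
        rintro _ ⟨y, ⟨hyX, hyQ⟩, rfl⟩ hxy
        rw [Q.chart.injOn (ChartCompact.mem_points.1 hyQ).1 (Q.tsupport_subset_source hxQ) hxy]
          at hyX
        exact hx hyX
      obtain ⟨ε, hε, hεx⟩ := (Q.isCompact_trace X).exists_cthickening_subset_open
        isOpen_compl_singleton hxF
      filter_upwards [tendsto_coe_comap.eventually (gt_mem_nhds hε)] with r hr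
      rw [Q.mulComp_apply, hb1 r _ fun h => hεx (cthickening_mono ((hδr r).trans hr.le) _ h) rfl,
        mul_one]
    · refine Eventually.of_forall fun r => ?_
      rw [Q.mulComp_apply, image_eq_zero_of_notMem_tsupport hxQ, zero_mul]
  · rw [add_mul]
    exact (norm_sub_le _ _).trans (add_le_add (hwC r f) (hv r f))

/-- An extendible distribution is the limit of `t β_r - c_r`, for a locally finite sum `β_r` of
cutoff functions and a locally finite sum `c_r` of differences as in
`MDistribution.exists_local_subtraction`. -/
theorem MDistribution.Extends.hasSubtractedLimit [T2Space M] [ParacompactSpace M] {X : Closeds M}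
    {t : MDistribution d X.compl} {u : MDistribution d (⊤ : Opens M)} (hu : u.Extends t) :
    HasSubtractedLimit t := by
  obtain ⟨κ, Q, hQ, hQ1⟩ := exists_chartCutoff_partition d M
  choose b hb w m C D hbX hb1 hw hwC hwD using fun i => u.exists_local_subtraction X (Q i)
  let v : κ → Ioc (0 : ℝ) 1 → SmoothFunction d M →ₗ[ℂ] ℂ := fun i r => u.toLinearMap ∘ₗ
    mulCompact ((Q i).mulComp (fun y => 1 - b i r y) (contDiff_const.sub (hb i r)))
      ((Q i).isCompact_tsupport_mulComp _ _)
  choose c hc using fun r => exists_locallyFinite_sum (L := fun i => (Q i).toChartCompact) hQ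
    (fun i => w i r - v i r) m (fun i => D i r) fun i f => hwD i r f
  have hg : ∀ r i, tsupport ((Q i).mulComp (b i r) (hb i r)) ⊆ (Q i).points := fun r i =>
    ((Q i).tsupport_mulComp_subset _ _).trans (Q i).tsupport_subset
  let β : Ioc (0 : ℝ) 1 → SmoothFunction d M := fun r =>
    locallyFiniteSmoothSum hQ (fun i => (Q i).mulComp (b i r) (hb i r)) (hg r)
  have hβX : ∀ r, VanishesNear (β r) X := fun r => by
    rw [VanishesNear, eventually_nhdsSet_iff_forall]
    intro x hx
    obtain ⟨U, hU, hUf⟩ := hQ x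
    have hall : ∀ᶠ y in 𝓝 x, ∀ i ∈ hUf.toFinset, (Q i).mulComp (b i r) (hb i r) y = 0 :=
      (Filter.eventually_all_finset _).2 fun i _ => (hbX i r).filter_mono (nhds_le_nhdsSet hx)
    filter_upwards [hU, hall] with y hyU hy
    refine (locallyFiniteSmoothSum_apply hQ _ _ (S := hUf.toFinset) fun i hi hyi => ?_).trans
      (Finset.sum_eq_zero hy)
    exact hi (hUf.mem_toFinset.2 ⟨y, hyi, hyU⟩)
  refine ⟨β, hβX, c, u, fun x hx => ?_, fun r x hx => ?_, fun φ => ?_, hu⟩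
  · have hS : ∀ i ∉ (hQ.point_finite x).toFinset, x ∉ (Q i).points := fun i hi hxi =>
      hi ((hQ.point_finite x).mem_toFinset.2 hxi)
    have hall : ∀ᶠ r in comap Subtype.val (𝓝[>] (0 : ℝ)), ∀ i ∈ (hQ.point_finite x).toFinset,
        (Q i).mulComp (b i r) (hb i r) x = (Q i).cutoff x :=
      (Filter.eventually_all_finset _).2 fun i _ => hb1 i x hx
    refine tendsto_const_nhds.congr' ?_
    filter_upwards [hall] with r hr
    refine Eq.symm ((locallyFiniteSmoothSum_apply hQ _ _ hS).trans ?_)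
    rw [Finset.sum_congr rfl hr, ← hQ1 x]
    refine (finsum_eq_sum_of_support_subset _ fun i hi => ?_).symm
    by_contra h
    exact hS i h ((Q i).tsupport_subset (subset_tsupport _ hi))
  · by_contra hxX
    refine hx.2 ⟨X.compl, hxX, fun φ hφ => ?_⟩
    obtain ⟨S, hS⟩ := exists_finset_disjoint (L := fun i => (Q i).toChartCompact) hQ φ.2.1
    rw [hc r φ S hS]
    refine Finset.sum_eq_zero fun i _ => ?_
    rw [LinearMap.sub_apply, sub_eq_zero]
    exact hw i r φ (vanishesNear_of_tsupport_subset hφ)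
  · obtain ⟨S, hS⟩ := exists_finset_disjoint (L := fun i => (Q i).toChartCompact) hQ φ.2.1
    -- On `φ`, the difference of `t β - c` and `u` is the finite sum of the small terms `w`.
    have hdiff : ∀ r, t (mulTest (β r) (hβX r) φ) - c r φ = u φ - ∑ i ∈ S, w i r φ := by
      intro r
      have hφ : Submodule.inclusion (testFunctions_mono le_top) (mulTest (β r) (hβX r) φ) =
          φ - ∑ i ∈ S, mulCompact ((Q i).mulComp (fun y => 1 - b i r y)
            (contDiff_const.sub (hb i r))) ((Q i).isCompact_tsupport_mulComp _ _)
              (φ : SmoothFunction d M) := by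
        apply Subtype.ext
        rw [AddSubgroupClass.coe_sub, Submodule.coe_sum]
        ext x
        have hφx := congrArg (fun f : SmoothFunction d M => f x) (sum_cutoff_mul_eq hQ1 hS)
        simp only [SmoothFunction.sum_apply, SmoothFunction.mul_apply] at hφx
        rw [SmoothFunction.sub_apply, SmoothFunction.sum_apply]
        simp only [coe_mulCompact, SmoothFunction.mul_apply, ChartCutoff.mulComp_apply]
        change β r x * (φ : SmoothFunction d M) x = _
        nth_rewrite 2 [← hφx]
        rw [← Finset.sum_sub_distrib]
        by_cases hx : x ∈ tsupport (φ : SmoothFunction d M)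
        · have hβx : β r x = ∑ i ∈ S, (Q i).mulComp (b i r) (hb i r) x :=
            locallyFiniteSmoothSum_apply hQ _ _ fun i hi hxi => (hS i hi).le_bot ⟨hxi, hx⟩
          rw [hβx, Finset.sum_mul]
          refine Finset.sum_congr rfl fun i _ => ?_
          rw [ChartCutoff.mulComp_apply]
          ring
        · simp [image_eq_zero_of_notMem_tsupport hx]
      rw [hc r φ S hS, ← hu, hφ, map_sub, map_sum]
      simp only [LinearMap.sub_apply, Finset.sum_sub_distrib]
      change _ - ∑ i ∈ S, v i r φ - (_ - ∑ i ∈ S, v i r φ) = _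
      ring
    have hw0 : ∀ i, Tendsto (fun r => w i r φ) (comap Subtype.val (𝓝[>] (0 : ℝ))) (𝓝 0) := by
      refine fun i => squeeze_zero_norm (fun r => hwC i r φ) ?_
      simpa using (tendsto_coe_comap.const_mul (C i)).mul_const
        (chartSeminorm (Q i).toChartCompact (m i) (φ : SmoothFunction d M))
    have hlim := tendsto_const_nhds (x := u φ) |>.sub (tendsto_finsetSum S fun i _ => hw0 i)
    rw [Finset.sum_const_zero, sub_zero] at hlim
    exact hlim.congr fun r => (hdiff r).symm

end Subtraction

end DistExt

end

theorem theorem5p1 {d : ℕ} {M : Type*} [TopologicalSpace M] [T2Space M] [ParacompactSpace M]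
    [ChartedSpace (EuclideanSpace ℝ (Fin d)) M] [IsManifold (𝓡 d) ∞ M]
    [RiemannianBundle (fun x : M => TangentSpace (𝓡 d) x)]
    [IsContMDiffRiemannianBundle (𝓡 d) ∞ (EuclideanSpace ℝ (Fin d))
      (fun x : M => TangentSpace (𝓡 d) x)]
    {ι : Type*} (𝒜 : DistExt.ChartFamily d M ι)
    (X : Closeds M) (t : DistExt.MDistribution d X.compl) :
    List.TFAE
      [DistExt.HasModerateGrowth 𝒜 t,
        ∃ u : DistExt.MDistribution d (⊤ : Opens M), u.Extends t,
        DistExt.HasSubtractedLimit t] := by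
  have : IsContinuousRiemannianBundle (EuclideanSpace ℝ (Fin d))
      (fun x : M => TangentSpace (𝓡 d) x) := by
    obtain ⟨g, hg, hgi⟩ := IsContMDiffRiemannianBundle.exists_contMDiff (IB := 𝓡 d) (n := ∞)
      (F := EuclideanSpace ℝ (Fin d)) (E := fun x : M => TangentSpace (𝓡 d) x)
    exact ⟨g, hg.continuous, hgi⟩
  tfae_have 1 → 2 := fun h => h.exists_extends
  tfae_have 2 → 1 := fun ⟨_, hu⟩ => hu.hasModerateGrowth 𝒜
  tfae_have 2 → 3 := fun ⟨_, hu⟩ => hu.hasSubtractedLimit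
  tfae_have 3 → 2 := fun ⟨_, _, _, u, _, _, _, hu⟩ => ⟨u, hu⟩
  tfae_finish
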